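/- Conventions. A tropical curve $\Gamma$ is a compact connected metric graph without infinite ends, i.e. the geometric representation of a finite connected graph (loops and multiple edges allowed) with a positive real length on each edge; any such weighted graph $G=(V,E)$ whose geometric representation is isometric to $\Gamma$ is called a model of $\Gamma$, and the genus is $g=|E|-|V|+1$. The degree of a point of $\Gamma$ is the number of tangent directions at it. A divisor is an element $D=\sum_v D(v)(v)$ of the free abelian group on the points of $\Gamma$, and $\deg D=\sum_v D(v)$. A rational function is a continuous function $f:\Gamma\to\mathbb R$ that is piecewise linear with integer slopes and finitely many linear parts on each edge; $\operatorname{div}(f)$ is the divisor whose coefficient at $v$ is the sum of the outgoing slopes of $f$ at $v$; $E\sim D$ means $E=D+\operatorname{div}(f)$ for some $f$; and $R(D)$ is the set of all $f$ with $D+\operatorname{div}(f)\ge 0$. $D$ is very ample if for all points $P\ne Q$ there are $f,h\in R(D)$ with $f(P)-h(P)\ne f(Q)-h(Q)$, and ample if $mD$ is very ample for some integer $m\ge1$. A divisor $E$ is $P$-reduced if $E(v)\ge0$ for all $v\ne P$ and every non-empty closed connected $X\subset\Gamma$ with $P\notin X$ has a boundary point $v$ such that $E(v)$ is smaller than the number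 of edges leaving $X$ at $v$. The banana graph of genus $g$ has two vertices, joined by $g+1$ parallel edges, and no other edges. Theorem. Let $\Gamma$ be a tropical curve of genus $g$. 1. Every divisor $D$ on $\Gamma$ with $\deg(D)\ge 2g+1$ is very ample. 2. If $\Gamma$ is not a single point, a divisor $D$ on $\Gamma$ is ample if and only if $\deg(D)>0$. 3. If $D$ is a divisor, $P\in\Gamma$, and $E\sim D$ is $P$-reduced, then $E(P)\ge\deg(D)-g$. 4. If $\Gamma$ has no points of degree one and no model of $\Gamma$ has the banana graph of genus $g$ as its underlying graph, then every divisor $D$ with $\deg(D)\ge 2g$ is very ample. 5. If $\Gamma$ has a model whose underlying graph is the banana graph of genus $g$, with vertices $P$ and $Q$, then the divisor $g(P)+g(Q)$, of degree $2g$, is not very ample. -/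

import Mathlib

open Filter Topology

universe u v w z

set_option linter.checkUnivs false

/-- A weighted graph: a finite graph (loops and multiple edges allowed) with a positive real
length on every edge. The orientation `src`, `tgt` of an edge only serves to parametrize it. -/
structure WeightedGraph where
  V : Type u
  E : Type v
  [fintypeV : Fintype V]
  [fintypeE : Fintype E]
  src : E → V
  tgt : E → V
  len : E → ℝ
  len_pos : ∀ e, 0 < len e

attribute [instance] WeightedGraph.fintypeV WeightedGraph.fintypeE

namespace WeightedGraph

/-- Two vertices can always be joined by a path of edges, and there is at least one vertex. -/
def Connected (Γ : WeightedGraph.{u, v}) : Prop :=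
  Nonempty Γ.V ∧
    ∀ a b : Γ.V, Relation.EqvGen (fun x y => ∃ e, Γ.src e = x ∧ Γ.tgt e = y) a b

/-- The genus `|E| - |V| + 1` (the first Betti number, for connected graphs). -/
def genus (Γ : WeightedGraph.{u, v}) : ℤ :=
  (Fintype.card Γ.E : ℤ) - (Fintype.card Γ.V : ℤ) + 1

/-- The points of the geometric representation of `Γ`: every edge `e` is replaced by an interval
of length `len e`, glued to the vertices at its two ends. -/
inductive Point (Γ : WeightedGraph.{u, v}) : Type (max u v)
  | vertex (x : Γ.V) : Point Γ
  | inner (e : Γ.E) (t : Set.Ioo (0 : ℝ) (Γ.len e)) : Point Γ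

variable {Γ : WeightedGraph.{u, v}}

/-- The parametrization `[0, len e] → Γ` of the edge `e` by arc length
(extended to `ℝ` by the end points). -/
noncomputable def edgePt (Γ : WeightedGraph.{u, v}) (e : Γ.E) (t : ℝ) : Γ.Point :=
  if h₀ : t ≤ 0 then .vertex (Γ.src e)
  else if h₁ : t < Γ.len e then .inner e ⟨t, lt_of_not_ge h₀, h₁⟩
  else .vertex (Γ.tgt e)

/-- The topology of the geometric representation (the quotient topology): a set is open iff its
preimage in every edge is open. -/
noncomputable instance : TopologicalSpace Γ.Point :=
  ⨆ e : Γ.E, TopologicalSpace.coinduced (Γ.edgePt e) inferInstance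

/-- An oriented edge: `(e, true)` runs from `src e` to `tgt e`, and `(e, false)` runs back. -/
abbrev OEdge (Γ : WeightedGraph.{u, v}) : Type v := Γ.E × Bool

/-- The vertex at which an oriented edge starts. -/
def start (d : Γ.OEdge) : Γ.V := if d.2 then Γ.src d.1 else Γ.tgt d.1

open Classical in
/-- The tangent directions at a point: at a vertex the oriented edges that start there (so a loop
gives two of them), and inside an edge the two orientations of that edge. -/
noncomputable def dirs : Γ.Point → Finset Γ.OEdge
  | .vertex x => Finset.univ.filter fun d => start d = x
  | .inner e _ => Finset.univ.filter fun d => d.1 = e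

/-- The position of a point `x` on the edge of `d`, where `d` is a direction at `x`. -/
def coord : Γ.Point → Γ.OEdge → ℝ
  | .vertex _, d => if d.2 then 0 else Γ.len d.1
  | .inner _ t, _ => t

/-- The point at distance `s` from `x` in the direction `d`, for small `s ≥ 0`. -/
noncomputable def walk (x : Γ.Point) (d : Γ.OEdge) (s : ℝ) : Γ.Point :=
  Γ.edgePt d.1 (if d.2 then coord x d + s else coord x d - s)

/-- The degree (valence) of a point. -/
noncomputable def deg (x : Γ.Point) : ℕ := (dirs x).card

/-- Divisors: the free abelian group on the points of `Γ`, with its coefficientwise order.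
The degree of a divisor is `Finsupp.degree`. -/
abbrev Divisor (Γ : WeightedGraph.{u, v}) := Γ.Point →₀ ℤ

/-- Rational functions: continuous and piecewise linear with integer slopes and finitely many
linear parts on every edge. (The linearity on closed segments includes the continuity.) -/
structure RationalFunction (Γ : WeightedGraph.{u, v}) where
  toFun : Γ.Point → ℝ
  piecewise_linear : ∀ e : Γ.E, ∃ S : Finset ℝ, ∀ a b : ℝ, 0 ≤ a → a ≤ b → b ≤ Γ.len e →
    (∀ s ∈ S, s ∉ Set.Ioo a b) →
    ∃ m : ℤ, ∀ s ∈ Set.Icc a b, toFun (Γ.edgePt e s) = toFun (Γ.edgePt e a) + m * (s - a)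

instance : CoeFun Γ.RationalFunction (fun _ => Γ.Point → ℝ) := ⟨RationalFunction.toFun⟩

open Classical in
/-- The outgoing slope at `x` of a function `f` in the direction `d`. -/
noncomputable def slope (f : Γ.Point → ℝ) (x : Γ.Point) (d : Γ.OEdge) : ℤ :=
  if h : ∃ m : ℤ, ∀ᶠ s in 𝓝[>] (0 : ℝ), f (walk x d s) = f x + m * s then h.choose else 0

/-- The order of `f` at `x`: the sum of the outgoing slopes. -/
noncomputable def ord (f : Γ.Point → ℝ) (x : Γ.Point) : ℤ := ∑ d ∈ dirs x, slope f x d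

theorem slope_eq {f : Γ.Point → ℝ} {x : Γ.Point} {d : Γ.OEdge} {m : ℤ}
    (h : ∀ᶠ s in 𝓝[>] (0 : ℝ), f (walk x d s) = f x + m * s) : slope f x d = m := by
  have h' : ∃ m : ℤ, ∀ᶠ s in 𝓝[>] (0 : ℝ), f (walk x d s) = f x + m * s := ⟨m, h⟩
  rw [slope, dif_pos h']
  obtain ⟨s, ⟨h1, h2⟩, h3⟩ :=
    ((h'.choose_spec.and h).and (self_mem_nhdsWithin : Set.Ioi (0 : ℝ) ∈ 𝓝[>] (0 : ℝ))).exists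
  have h3 : 0 < s := h3
  have : ((h'.choose : ℤ) : ℝ) * s = (m : ℝ) * s := by linarith
  exact_mod_cast mul_right_cancel₀ h3.ne' this

theorem edgePt_inner (e : Γ.E) (t : Set.Ioo (0 : ℝ) (Γ.len e)) :
    Γ.edgePt e t = .inner e t := by
  rw [edgePt, dif_neg (not_le.2 t.2.1), dif_pos t.2.2]

theorem dirs_inner (e : Γ.E) (t : Set.Ioo (0 : ℝ) (Γ.len e)) (F : Γ.OEdge → ℤ) :
    ∑ d ∈ dirs (Point.inner e t), F d = F (e, true) + F (e, false) := by
  classical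
  have : dirs (Point.inner e t) = {(e, true), (e, false)} := by
    ext ⟨e', b⟩
    cases b <;> simp [dirs]
  rw [this, Finset.sum_pair (by simp)]

theorem ord_finite (f : Γ.RationalFunction) : (Function.support (ord f)).Finite := by
  choose S hS using f.piecewise_linear
  have hfin : (Set.range (Point.vertex : Γ.V → Γ.Point) ∪
      ⋃ e : Γ.E, Γ.edgePt e '' (S e : Set ℝ)).Finite :=
    (Set.finite_range _).union
      (Set.finite_iUnion fun e => (S e).finite_toSet.image _)
  refine hfin.subset ?_
  rintro (x | ⟨e, t⟩) hx
  · exact Or.inl ⟨x, rfl⟩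
  refine Or.inr (Set.mem_iUnion.2 ⟨e, ?_⟩)
  by_contra hmem
  have ht : (t : ℝ) ∉ S e := fun h => hmem ⟨t, h, edgePt_inner e t⟩
  apply hx
  have hU : Set.Ioo 0 (Γ.len e) ∩ (S e : Set ℝ)ᶜ ∈ 𝓝 (t : ℝ) :=
    inter_mem (isOpen_Ioo.mem_nhds t.2) ((S e).finite_toSet.isClosed.isOpen_compl.mem_nhds ht)
  obtain ⟨r, hr, hball⟩ := Metric.mem_nhds_iff.1 hU
  rw [Real.ball_eq_Ioo] at hball
  have hin : ∀ y, (t : ℝ) - r < y → y < t + r → (0 < y ∧ y < Γ.len e) ∧ y ∉ S e :=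
    fun y h1 h2 => hball ⟨h1, h2⟩
  obtain ⟨m, hm⟩ := hS e (t - r / 2) (t + r / 2)
    (hin _ (by linarith) (by linarith)).1.1.le (by linarith)
    (hin _ (by linarith) (by linarith)).1.2.le
    (fun s hs hs' => (hin s (by linarith [hs'.1]) (by linarith [hs'.2])).2 hs)
  have h0 := hm t ⟨by linarith, by linarith⟩
  rw [edgePt_inner] at h0
  have hsmall : ∀ᶠ s in 𝓝[>] (0 : ℝ), s ∈ Set.Ioo (0 : ℝ) (r / 2) :=
    Ioo_mem_nhdsGT (by linarith)
  have hp : slope f (.inner e t) (e, true) = m := by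
    refine slope_eq (hsmall.mono fun s hs => ?_)
    have h1 := hm (t + s) ⟨by linarith [hs.1], by linarith [hs.2]⟩
    simp only [walk, coord, if_true]
    rw [h1, h0]; ring
  have hn : slope f (.inner e t) (e, false) = -m := by
    refine slope_eq (hsmall.mono fun s hs => ?_)
    have h1 := hm (t - s) ⟨by linarith [hs.2], by linarith [hs.1]⟩
    simp only [walk, coord, Bool.false_eq_true, if_false]
    rw [h1, h0]; push_cast; ring
  rw [ord, dirs_inner, hp, hn]; ring

/-- The principal divisor of a rational function. -/
noncomputable def RationalFunction.div (f : Γ.RationalFunction) : Γ.Divisor :=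
  Finsupp.ofSupportFinite (ord f) (ord_finite f)

/-- `D ∼ D'`. -/
def LinEquiv (D D' : Γ.Divisor) : Prop := ∃ f : Γ.RationalFunction, D = D' + f.div

/-- `R(D)`: the rational functions `f` with `D + div f ≥ 0`. -/
def R (D : Γ.Divisor) : Set Γ.RationalFunction := {f | 0 ≤ D + f.div}

/-- `D` is very ample if `R(D)` separates the points of `Γ`. -/
def VeryAmple (D : Γ.Divisor) : Prop :=
  ∀ P Q : Γ.Point, P ≠ Q → ∃ f ∈ R D, ∃ g ∈ R D, f P - g P ≠ f Q - g Q

/-- `D` is ample if a positive integer multiple of `D` is very ample. -/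
def Ample (D : Γ.Divisor) : Prop := ∃ m : ℕ, 0 < m ∧ VeryAmple (m • D)

open Classical in
/-- The number of edges leaving `X` at `x`, i.e. the number of directions at `x` in which there
is a segment starting at `x` that is otherwise disjoint from `X`. -/
noncomputable def outDeg (X : Set Γ.Point) (x : Γ.Point) : ℕ :=
  ((dirs x).filter fun d => ∃ ε > (0 : ℝ), ∀ s ∈ Set.Ioc 0 ε, walk x d s ∉ X).card

/-- `D` is `P`-reduced. (`IsConnected` includes non-emptiness.) -/
def IsReduced (P : Γ.Point) (D : Γ.Divisor) : Prop :=
  (∀ x, x ≠ P → 0 ≤ D x) ∧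
    ∀ X : Set Γ.Point, IsClosed X → IsConnected X → P ∉ X →
      ∃ x ∈ frontier X, D x < (outDeg X x : ℤ)

/-- An isometry between the geometric representations of two weighted graphs for their length
metrics: a bijection which at every point `x` maps the unit speed segments emanating from `x`,
near `x`, one-to-one onto the unit speed segments emanating from the image of `x`.
If there is one, `H` is a model of the metric graph `Γ`. -/
structure MetricIso (H : WeightedGraph.{u, v}) (Γ : WeightedGraph.{w, z}) extends H.Point ≃ Γ.Point where
  local_isometry : ∀ x : H.Point, ∃ σ : H.OEdge → Γ.OEdge,
    Set.BijOn σ (dirs x) (dirs (toFun x)) ∧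
      ∀ d ∈ dirs x, ∀ᶠ s in 𝓝[>] (0 : ℝ), toFun (walk x d s) = walk (toFun x) (σ d) s

/-- The graph underlying `H` is the banana graph of genus `g` with the two vertices `p` and `q`:
these are distinct, there are no others, and there are `g + 1` edges, all joining `p` and `q`. -/
def IsBanana (H : WeightedGraph.{u, v}) (g : ℤ) (p q : H.V) : Prop :=
  p ≠ q ∧ (∀ x : H.V, x = p ∨ x = q) ∧ (Fintype.card H.E : ℤ) = g + 1 ∧
    ∀ e, (H.src e = p ∧ H.tgt e = q) ∨ (H.src e = q ∧ H.tgt e = p)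

end WeightedGraph

/-!
Everything rests on reduced divisors, described by functions instead of closed sets
(`IsFunRed`): `E` is effective away from `P`, and every `h` that keeps `E` effective away from `P`
is maximal at `P`. A divisor that is reduced in the usual sense has this property
(`IsReduced.isFunRed`): otherwise, adding `div h` would move chips out of a component of the set
where `h` is maximal, which does not contain `P`.

*Existence* (`exists_isFunRed`). Finitely many chips at `P` make `R(D)` non-empty
(`exists_eff_add`). The functions in `R(D)` have slopes bounded by a degree (`slope_le_degree`) and
are convex between the points of `D`, so their pointwise supremum, normalized at `P`, has bounded
integral subgradients. Hence it is again piecewise linear with integral slopes, and it belongs to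
`R(D)` (`exists_greatest`); adding it to `D` gives the reduced divisor.

*The coefficient at `P`* (`IsFunRed.degree_sub_genus_le`). After a subdivision `P` and the points of
`E` are vertices. Firing a set `A` of vertices not containing `P` shows that some `v` in `A` has
fewer chips than there are edges from `v` out of `A`; removing these vertices one after the other
gives `deg E - E P ≤ g`.

*Very ampleness.* If `R(D)` does not separate `P` and `Q`, the function relating the reduced divisors
at the two points has its maximum at `P` and its minimum at `Q`, with the same value, so that the two
divisors agree (`exists_isFunRed_isFunRed`). Then `E P` and `E Q` are both at least `deg D - g`, which
is impossible for `deg D > 2g`. For `deg D = 2g`, both are at least `g`, so firing `P` or `Q` shows that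
at least `g + 1` edges leave these points; as the sum of `deg x - 2` over all points is `2g - 2`,
all other points have degree two. Removing the other vertices (`exists_model_without_vertex`), a
graph with two vertices and `g + 1` edges is left, all of them joining `P` to `Q`
(`exists_banana`). Conversely, on a banana graph a function in `R(gP + gQ)` with a larger value at
`P` than at `Q` would, by convexity, decrease along all `g + 1` edges at `P`
(`IsBanana.le_of_ord`).
-/

namespace WeightedGraph

/-! ### Germs of piecewise linear functions on the line -/

/-- `φ` is linear with slope `m` immediately to the right of `u`. -/
def RSlope (φ : ℝ → ℝ) (u m : ℝ) : Prop := ∀ᶠ s in 𝓝[>] (0 : ℝ), φ (u + s) = φ u + m * s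

/-- `φ` is linear immediately to the left of `u`, with *outgoing* slope `m`. -/
def LSlope (φ : ℝ → ℝ) (u m : ℝ) : Prop := ∀ᶠ s in 𝓝[>] (0 : ℝ), φ (u - s) = φ u + m * s

theorem exists_pos_of_eventually {p : ℝ → Prop} (h : ∀ᶠ s in 𝓝[>] (0 : ℝ), p s) {b : ℝ}
    (hb : 0 < b) : ∃ δ, 0 < δ ∧ δ < b ∧ ∀ s, 0 < s → s ≤ δ → p s := by
  obtain ⟨c, hc, hs⟩ := mem_nhdsGT_iff_exists_Ioo_subset.1 h
  have hc : 0 < c := hc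
  refine ⟨min c b / 2, by positivity, ?_, fun s h0 h1 => hs ⟨h0, ?_⟩⟩
  · linarith [min_le_right c b, lt_min hc hb]
  · linarith [min_le_left c b, lt_min hc hb]

theorem eventually_of_pos {p : ℝ → Prop} {δ : ℝ} (hδ : 0 < δ) (h : ∀ s, 0 < s → s < δ → p s) :
    ∀ᶠ s in 𝓝[>] (0 : ℝ), p s :=
  mem_nhdsGT_iff_exists_Ioo_subset.2 ⟨δ, hδ, fun s hs => h s hs.1 hs.2⟩

theorem LSlope.neg {φ : ℝ → ℝ} {u m : ℝ} (h : LSlope φ u m) : RSlope (fun x => φ (-x)) (-u) m := by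
  refine Filter.Eventually.mono h fun s hs => ?_
  simp only [neg_neg]
  rw [← hs]; congr 1; ring

theorem RSlope.neg {φ : ℝ → ℝ} {u m : ℝ} (h : RSlope φ u m) : LSlope (fun x => φ (-x)) (-u) m := by
  refine Filter.Eventually.mono h fun s hs => ?_
  simp only [neg_neg]
  rw [← hs]; congr 1; ring

theorem RSlope.continuousWithinAt {φ : ℝ → ℝ} {u m : ℝ} (h : RSlope φ u m) :
    ContinuousWithinAt φ (Set.Ici u) u := by
  obtain ⟨δ, h0, -, h1⟩ := exists_pos_of_eventually h one_pos
  have hc : ContinuousWithinAt (fun y => φ u + m * (y - u)) (Set.Ici u) u := by fun_prop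
  refine hc.congr_of_eventuallyEq ?_ (by simp)
  have : Set.Ico u (u + δ) ∈ 𝓝[≥] u := Ico_mem_nhdsGE (by linarith)
  filter_upwards [this] with y hy
  rcases hy.1.eq_or_lt with rfl | hlt
  · simp
  · rw [← h1 (y - u) (by linarith) (by linarith [hy.2])]; congr 1; ring

theorem LSlope.continuousWithinAt {φ : ℝ → ℝ} {u m : ℝ} (h : LSlope φ u m) :
    ContinuousWithinAt φ (Set.Iic u) u := by
  have h1 := h.neg.continuousWithinAt
  have h2 : ContinuousWithinAt (fun x : ℝ => -x) (Set.Iic u) u := by fun_prop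
  have := h1.comp h2 (fun x hx => by simpa using hx)
  simpa [Function.comp_def] using this

theorem continuousOn_of_slopes {φ : ℝ → ℝ} {a b : ℝ} (hr : ∀ u, a ≤ u → u < b → ∃ m, RSlope φ u m)
    (hl : ∀ u, a < u → u ≤ b → ∃ m, LSlope φ u m) : ContinuousOn φ (Set.Icc a b) := by
  intro u hu
  have h : ContinuousWithinAt φ (Set.Icc a u ∪ Set.Icc u b) u := by
    refine ContinuousWithinAt.union ?_ ?_
    · rcases hu.1.eq_or_lt with rfl | hlt
      · simp
      · exact (hl u hlt hu.2).choose_spec.continuousWithinAt.mono Set.Icc_subset_Iic_self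
    · rcases hu.2.eq_or_lt with rfl | hlt
      · simp
      · exact (hr u hu.1 hlt).choose_spec.continuousWithinAt.mono Set.Icc_subset_Ici_self
  rwa [Set.Icc_union_Icc_eq_Icc hu.1 hu.2] at h

/-- `φ` is continuous on `[a, b]` and locally convex in the interior, in terms of the outgoing
slopes. -/
def LocConvexOn (φ : ℝ → ℝ) (a b : ℝ) : Prop :=
  ContinuousOn φ (Set.Icc a b) ∧
    ∀ u, a < u → u < b → ∃ r l, RSlope φ u r ∧ LSlope φ u l ∧ 0 ≤ r + l

theorem LocConvexOn.mono {φ : ℝ → ℝ} {a b c d : ℝ} (h : LocConvexOn φ a b) (hc : a ≤ c)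
    (hd : d ≤ b) : LocConvexOn φ c d :=
  ⟨h.1.mono (Set.Icc_subset_Icc hc hd), fun u h1 h2 => h.2 u (hc.trans_lt h1) (h2.trans_le hd)⟩

theorem LocConvexOn.add_linear {φ : ℝ → ℝ} {a b : ℝ} (h : LocConvexOn φ a b) (k c : ℝ) :
    LocConvexOn (fun x => φ x + (k * x + c)) a b := by
  refine ⟨h.1.add (by fun_prop), fun u h1 h2 => ?_⟩
  obtain ⟨r, l, hr, hl, h0⟩ := h.2 u h1 h2
  exact ⟨r + k, l - k, hr.mono fun s hs => by simp only [hs]; ring,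
    hl.mono fun s hs => by simp only [hs]; ring, by linarith⟩

theorem LocConvexOn.comp_neg {φ : ℝ → ℝ} {a b : ℝ} (h : LocConvexOn φ a b) :
    LocConvexOn (fun x => φ (-x)) (-b) (-a) := by
  refine ⟨h.1.comp (by fun_prop) fun x hx => ⟨by linarith [hx.2], by linarith [hx.1]⟩,
    fun u h1 h2 => ?_⟩
  obtain ⟨r, l, hr, hl, h0⟩ := h.2 (-u) (by linarith) (by linarith)
  exact ⟨l, r, by simpa using hl.neg, by simpa using hr.neg, by linarith⟩

/-- The maximum principle: at the last point where an interior maximum is attained, the slope to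
the right would have to vanish. -/
theorem LocConvexOn.le_max {φ : ℝ → ℝ} {a b : ℝ} (h : LocConvexOn φ a b) {t : ℝ}
    (ht : t ∈ Set.Icc a b) : φ t ≤ max (φ a) (φ b) := by
  obtain ⟨c, hc, hmax⟩ := isCompact_Icc.exists_isMaxOn ⟨t, ht⟩ h.1
  by_contra! hlt
  have hM : max (φ a) (φ b) < φ c := hlt.trans_le (hmax ht)
  have hK : IsCompact (Set.Icc a b ∩ φ ⁻¹' {φ c}) :=
    isCompact_Icc.of_isClosed_subset
      (h.1.preimage_isClosed_of_isClosed isClosed_Icc isClosed_singleton) Set.inter_subset_left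
  obtain ⟨hu, huc⟩ := hK.sSup_mem ⟨c, hc, rfl⟩
  set u := sSup (Set.Icc a b ∩ φ ⁻¹' {φ c}) with hu_def
  have huc : φ u = φ c := huc
  have hua : a < u := lt_of_le_of_ne hu.1 fun he => by
    rw [← he] at huc; linarith [le_max_left (φ a) (φ b)]
  have hub : u < b := lt_of_le_of_ne hu.2 fun he => by
    rw [he] at huc; linarith [le_max_right (φ a) (φ b)]
  obtain ⟨r, l, hr, hl, h0⟩ := h.2 u hua hub
  obtain ⟨δ, hδ, hδb, hrδ⟩ := exists_pos_of_eventually hr (b := b - u) (by linarith)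
  obtain ⟨η, hη, hηb, hlη⟩ := exists_pos_of_eventually hl (b := u - a) (by linarith)
  have h1 : φ (u + δ) ≤ φ c := hmax ⟨by linarith, by linarith⟩
  have h2 : φ (u - η) ≤ φ c := hmax ⟨by linarith, by linarith⟩
  rw [hrδ δ hδ le_rfl, huc] at h1
  rw [hlη η hη le_rfl, huc] at h2
  have hr0 : r ≤ 0 := by by_contra! hh; nlinarith [mul_pos hh hδ]
  have hl0 : l ≤ 0 := by by_contra! hh; nlinarith [mul_pos hh hη]
  have hr0 : r = 0 := by linarith
  have hmem : u + δ ∈ Set.Icc a b ∩ φ ⁻¹' {φ c} :=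
    ⟨⟨by linarith, by linarith⟩, by
      show φ (u + δ) = φ c
      rw [hrδ δ hδ le_rfl, huc, hr0]; ring⟩
  have := le_csSup hK.bddAbove hmem
  linarith

/-- A locally convex function lies above its right tangent. -/
theorem LocConvexOn.tangent_le {φ : ℝ → ℝ} {a b m : ℝ} (h : LocConvexOn φ a b)
    (hm : RSlope φ a m) {t : ℝ} (ht : t ∈ Set.Icc a b) : φ a + m * (t - a) ≤ φ t := by
  by_contra! hlt
  have hat : a < t := lt_of_le_of_ne ht.1 fun he => by subst he; simp at hlt
  -- tilt the function a bit, so that it first increases and is negative at `t`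
  set η := (φ a + m * (t - a) - φ t) / (2 * (t - a)) with hη
  have hη0 : 0 < η := div_pos (by linarith) (by linarith)
  have hηt : η * (t - a) = (φ a + m * (t - a) - φ t) / 2 := by
    rw [hη]; field_simp [(sub_pos.2 hat).ne']
  have h' := (h.mono le_rfl ht.2).add_linear (η - m) (-φ a - (η - m) * a)
  obtain ⟨δ, hδ, hδt, hs⟩ := exists_pos_of_eventually hm (b := t - a) (by linarith)
  have := h'.le_max (t := a + δ) ⟨by linarith, by linarith⟩
  rw [hs δ hδ le_rfl] at this
  rcases le_max_iff.1 this with h1 | h1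
  · nlinarith [mul_pos hη0 hδ]
  · nlinarith [mul_pos hη0 hδ]

theorem LocConvexOn.tangent_le_left {φ : ℝ → ℝ} {a b m : ℝ} (h : LocConvexOn φ a b)
    (hm : LSlope φ b m) {t : ℝ} (ht : t ∈ Set.Icc a b) : φ b + m * (b - t) ≤ φ t := by
  have := h.comp_neg.tangent_le hm.neg (t := -t) ⟨by linarith [ht.2], by linarith [ht.1]⟩
  simp only [neg_neg] at this
  linarith

/-- A locally convex function has its right slope at `s` as a subgradient. -/
theorem LocConvexOn.subgradient {φ : ℝ → ℝ} {a b s r l : ℝ} (h : LocConvexOn φ a b)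
    (hs : s ∈ Set.Icc a b) (hr : RSlope φ s r) (hl : a < s → LSlope φ s l) (h0 : a < s → 0 ≤ r + l)
    {t : ℝ} (ht : t ∈ Set.Icc a b) : φ s + r * (t - s) ≤ φ t := by
  rcases le_or_gt s t with hst | hst
  · exact (h.mono hs.1 le_rfl).tangent_le hr ⟨hst, ht.2⟩
  · have := (h.mono le_rfl hs.2).tangent_le_left (hl (ht.1.trans_lt hst)) ⟨ht.1, hst.le⟩
    nlinarith [h0 (ht.1.trans_lt hst)]

theorem le_of_rslope_le {φ : ℝ → ℝ} {a b C : ℝ} (hab : a ≤ b) (hc : ContinuousOn φ (Set.Icc a b))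
    (h : ∀ u, a ≤ u → u < b → ∃ m ≤ C, RSlope φ u m) : φ b ≤ φ a + C * (b - a) := by
  choose! m hmC hm using h
  refine image_le_of_deriv_right_le_deriv_boundary (f := φ) (f' := m) (a := a) (b := b)
    (B := fun x => φ a + C * (x - a)) (B' := fun _ => C) hc ?_ (by simp) (by fun_prop) ?_ ?_
    ⟨hab, le_rfl⟩
  · intro x hx
    obtain ⟨δ, h0, -, h1⟩ := exists_pos_of_eventually (hm x hx.1 hx.2) one_pos
    have hd : HasDerivWithinAt (fun y => φ x + m x * (y - x)) (m x) (Set.Ici x) x := by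
      have := (((hasDerivAt_id x).sub_const x).const_mul (m x)).const_add (φ x)
      simpa using this.hasDerivWithinAt
    refine hd.congr_of_eventuallyEq ?_ (by simp)
    filter_upwards [Ico_mem_nhdsGE (show x < x + δ by linarith)] with y hy
    rcases hy.1.eq_or_lt with rfl | hlt
    · simp
    · rw [← h1 (y - x) (by linarith) (by linarith [hy.2])]; congr 1; ring
  · intro x _
    have := (((hasDerivAt_id x).sub_const a).const_mul C).const_add (φ a)
    simpa using this.hasDerivWithinAt
  · intro x hx
    exact hmC x hx.1 hx.2

/-- A function on `[0, δ]` with an integral subgradient at every point is linear near `0`: the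
subgradients increase with the point, so they are constant where they are minimal. -/
theorem exists_rslope_of_subgradients {φ : ℝ → ℝ} {δ : ℝ} {C : ℤ} (hδ : 0 < δ)
    (h : ∀ s ∈ Set.Icc 0 δ, ∃ m : ℤ, -C ≤ m ∧ ∀ t ∈ Set.Icc 0 δ, φ s + m * (t - s) ≤ φ t) :
    ∃ m : ℤ, RSlope φ 0 m := by
  have hex : ∃ n : ℤ, ∃ s, 0 < s ∧ s ≤ δ ∧ ∀ t ∈ Set.Icc 0 δ, φ s + n * (t - s) ≤ φ t := by
    obtain ⟨m, -, hm⟩ := h δ ⟨hδ.le, le_rfl⟩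
    exact ⟨m, δ, hδ, le_rfl, hm⟩
  have hbd : ∀ n : ℤ, (∃ s, 0 < s ∧ s ≤ δ ∧ ∀ t ∈ Set.Icc 0 δ, φ s + n * (t - s) ≤ φ t) →
      -C ≤ n := by
    rintro n ⟨s, hs, hsδ, hn⟩
    obtain ⟨m, hm, hm'⟩ := h 0 ⟨le_rfl, hδ.le⟩
    have h1 := hn 0 ⟨le_rfl, hδ.le⟩
    have h2 := hm' s ⟨hs.le, hsδ⟩
    have h3 : ((m : ℝ) - n) * s ≤ 0 := by linarith
    have : (m : ℝ) ≤ n := by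
      by_contra! hh
      nlinarith [mul_pos (sub_pos.2 hh) hs]
    exact hm.trans (by exact_mod_cast this)
  obtain ⟨m₀, ⟨s₀, hs0, hs0δ, hm₀⟩, hmin⟩ := Int.exists_least_of_bdd ⟨-C, hbd⟩ hex
  have key : ∀ s, 0 < s → s ≤ s₀ → ∀ t ∈ Set.Icc 0 δ, φ s + m₀ * (t - s) ≤ φ t := by
    intro s hs hss
    obtain ⟨m, -, hm⟩ := h s ⟨hs.le, hss.trans hs0δ⟩
    have h1 : m₀ ≤ m := hmin m ⟨s, hs, hss.trans hs0δ, hm⟩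
    rcases hss.eq_or_lt with rfl | hlt
    · exact hm₀
    have h2 := hm s₀ ⟨hs0.le, hs0δ⟩
    have h3 := hm₀ s ⟨hs.le, hss.trans hs0δ⟩
    have h4 : ((m : ℝ) - m₀) * (s₀ - s) ≤ 0 := by linarith
    have h5 : (m : ℝ) ≤ m₀ := by
      by_contra! hh
      nlinarith [mul_pos (sub_pos.2 hh) (sub_pos.2 hlt)]
    have h6 : m = m₀ := le_antisymm (by exact_mod_cast h5) h1
    rwa [h6] at hm
  refine ⟨m₀, eventually_of_pos hs0 fun s hs hss => ?_⟩
  rw [zero_add]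
  refine le_antisymm ?_ ?_
  · have := key s hs hss.le 0 ⟨le_rfl, hδ.le⟩
    linarith
  · obtain ⟨m, -, hm⟩ := h 0 ⟨le_rfl, hδ.le⟩
    by_contra! hlt
    -- compare with a point `s'` so close to `0` that the gap is larger than `|m - m₀| s'`
    set g := φ 0 + m₀ * s - φ s with hg
    have hg0 : 0 < g := by linarith
    set s' := min s (g / (2 * (|(m₀ : ℝ) - m| + 1))) with hs'
    have hp : 0 < |(m₀ : ℝ) - m| + 1 := by positivity
    have hs'0 : 0 < s' := lt_min hs (by positivity)
    have hs's : s' ≤ s := min_le_left _ _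
    have h1 := hm s' ⟨hs'0.le, by linarith⟩
    have h2 := key s hs hss.le s' ⟨hs'0.le, by linarith⟩
    have h3 := key s' hs'0 (by linarith) s ⟨hs.le, by linarith⟩
    have h4 : s' * (2 * (|(m₀ : ℝ) - m| + 1)) ≤ g := by
      rw [← le_div_iff₀ (by positivity)]; exact min_le_right _ _
    have h5 : ((m₀ : ℝ) - m) * s' ≤ |(m₀ : ℝ) - m| * s' :=
      mul_le_mul_of_nonneg_right (le_abs_self _) hs'0.le
    nlinarith

/-! ### Oriented edges and germs of rational functions -/

section Germs

variable {Γ : WeightedGraph.{u, v}}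

/-- The oriented edge with the opposite orientation. -/
def rev (d : Γ.OEdge) : Γ.OEdge := (d.1, !d.2)

/-- The vertex at which an oriented edge ends. -/
def finish (d : Γ.OEdge) : Γ.V := start (rev d)

/-- The point at distance `s` from the start of the oriented edge `d`. This treats the two
orientations of an edge alike, which `edgePt` does not. -/
noncomputable def opt (d : Γ.OEdge) (s : ℝ) : Γ.Point :=
  Γ.edgePt d.1 (if d.2 then s else Γ.len d.1 - s)

@[simp] theorem rev_rev (d : Γ.OEdge) : rev (rev d) = d := by simp [rev]

@[simp] theorem rev_fst (d : Γ.OEdge) : (rev d).1 = d.1 := rfl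

theorem rev_ne (d : Γ.OEdge) : rev d ≠ d := by
  rcases d with ⟨e, b⟩; simp [rev]

theorem eq_or_eq_rev_of_fst_eq {d d' : Γ.OEdge} (h : d.1 = d'.1) : d = d' ∨ d = rev d' := by
  rcases d with ⟨e, b⟩; rcases d' with ⟨e', b'⟩
  have h : e = e' := h
  subst h
  cases b <;> cases b' <;> simp [rev]

@[simp] theorem start_rev (d : Γ.OEdge) : start (rev d) = finish d := rfl

@[simp] theorem finish_rev (d : Γ.OEdge) : finish (rev d) = start d := by simp [finish]

theorem opt_rev (d : Γ.OEdge) (s : ℝ) : opt (rev d) s = opt d (Γ.len d.1 - s) := by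
  rcases d with ⟨e, b⟩
  cases b <;> simp [opt, rev]

theorem opt_true (e : Γ.E) (s : ℝ) : opt (e, true) s = Γ.edgePt e s := by simp [opt]

theorem opt_of_nonpos (d : Γ.OEdge) {s : ℝ} (hs : s ≤ 0) : opt d s = .vertex (start d) := by
  rcases d with ⟨e, b⟩
  have := Γ.len_pos e
  cases b
  · simp only [opt, edgePt, start, Bool.false_eq_true, if_false]
    rw [dif_neg (by linarith), dif_neg (by linarith)]
  · simp [opt, edgePt, start, hs]

@[simp] theorem opt_zero (d : Γ.OEdge) : opt d 0 = .vertex (start d) := opt_of_nonpos d le_rfl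

theorem opt_of_len_le (d : Γ.OEdge) {s : ℝ} (hs : Γ.len d.1 ≤ s) :
    opt d s = .vertex (finish d) := by
  have := opt_rev (rev d) s
  rw [rev_rev] at this
  rw [this, opt_of_nonpos _ (by simpa using hs), start_rev]

@[simp] theorem opt_len (d : Γ.OEdge) : opt d (Γ.len d.1) = .vertex (finish d) :=
  opt_of_len_le d le_rfl

theorem opt_inner (d : Γ.OEdge) {s : ℝ} (h0 : 0 < s) (h1 : s < Γ.len d.1) :
    opt d s = .inner d.1 ⟨if d.2 then s else Γ.len d.1 - s, by
      split_ifs <;> constructor <;> linarith⟩ := by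
  rw [← edgePt_inner]; rfl

theorem inner_eq_opt (e : Γ.E) (t : Set.Ioo (0 : ℝ) (Γ.len e)) :
    Point.inner e t = opt (e, true) t := by
  rw [opt_true, edgePt_inner]

theorem mem_dirs_vertex {v : Γ.V} {d : Γ.OEdge} : d ∈ dirs (.vertex v) ↔ start d = v := by
  simp [dirs]

theorem mem_dirs_inner {e : Γ.E} {t : Set.Ioo (0 : ℝ) (Γ.len e)} {d : Γ.OEdge} :
    d ∈ dirs (.inner e t) ↔ d.1 = e := by
  simp [dirs]

theorem mem_dirs_opt (d : Γ.OEdge) {u : ℝ} (h1 : u < Γ.len d.1) :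
    d ∈ dirs (opt d u) := by
  rcases le_or_gt u 0 with h | h
  · rw [opt_of_nonpos d h, mem_dirs_vertex]
  · rw [opt_inner d h h1, mem_dirs_inner]

theorem exists_opt_of_mem_dirs {x : Γ.Point} {d : Γ.OEdge} (h : d ∈ dirs x) :
    ∃ u, 0 ≤ u ∧ u < Γ.len d.1 ∧ x = opt d u := by
  rcases x with v | ⟨e, t⟩
  · rw [mem_dirs_vertex] at h
    exact ⟨0, le_rfl, Γ.len_pos _, by rw [opt_zero, h]⟩
  · rw [mem_dirs_inner] at h
    subst h
    rcases d with ⟨e, b⟩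
    cases b
    · refine ⟨Γ.len e - t, by linarith [t.2.2], by linarith [t.2.1], ?_⟩
      rw [← edgePt_inner]; simp [opt]
    · exact ⟨t, t.2.1.le, t.2.2, inner_eq_opt e t⟩

theorem walk_opt (d : Γ.OEdge) {u : ℝ} (h0 : 0 ≤ u) (h1 : u < Γ.len d.1) (s : ℝ) :
    walk (opt d u) d s = opt d (u + s) := by
  rcases h0.eq_or_lt with rfl | h0
  · rw [opt_zero]
    rcases d with ⟨e, b⟩
    cases b <;> simp [walk, coord, opt]
  · rw [opt_inner d h0 h1]
    rcases d with ⟨e, b⟩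
    cases b
    · simp only [walk, coord, opt, Bool.false_eq_true, if_false]; congr 1; ring
    · simp [walk, coord, opt]

theorem walk_zero {x : Γ.Point} {d : Γ.OEdge} (h : d ∈ dirs x) : walk x d 0 = x := by
  obtain ⟨u, h0, h1, rfl⟩ := exists_opt_of_mem_dirs h
  rw [walk_opt d h0 h1, add_zero]

theorem opt_injOn {d : Γ.OEdge} {s t : ℝ} (h0 : 0 < s) (h1 : s < Γ.len d.1) (h : opt d s = opt d t) :
    s = t := by
  rcases le_or_gt t 0 with ht | ht
  · rw [opt_inner d h0 h1, opt_of_nonpos d ht] at h; cases h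
  rcases lt_or_ge t (Γ.len d.1) with ht' | ht'
  · rw [opt_inner d h0 h1, opt_inner d ht ht'] at h
    have h := congrArg Subtype.val (eq_of_heq (Point.inner.inj h).2)
    simp only at h
    split_ifs at h <;> linarith
  · rw [opt_inner d h0 h1, opt_of_len_le d ht'] at h; cases h

/-- Inside an edge the two directions are opposite. -/
theorem sum_dirs_opt (d : Γ.OEdge) {u : ℝ} (h0 : 0 < u) (h1 : u < Γ.len d.1) (F : Γ.OEdge → ℤ) :
    ∑ d' ∈ dirs (opt d u), F d' = F d + F (rev d) := by
  rw [opt_inner d h0 h1, dirs_inner]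
  rcases d with ⟨e, b⟩
  cases b <;> simp [rev, add_comm]

/-- Functions that are linear with an integral slope near every point in every direction. On a
(compact) metric graph these are the rational functions. -/
def LocPL (f : Γ.Point → ℝ) : Prop :=
  ∀ x, ∀ d ∈ dirs x, ∃ m : ℤ, ∀ᶠ s in 𝓝[>] (0 : ℝ), f (walk x d s) = f x + m * s

theorem LocPL.slope_spec {f : Γ.Point → ℝ} (hf : LocPL f) {x : Γ.Point} {d : Γ.OEdge}
    (hd : d ∈ dirs x) : ∀ᶠ s in 𝓝[>] (0 : ℝ), f (walk x d s) = f x + slope f x d * s := by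
  obtain ⟨m, hm⟩ := hf x d hd
  rwa [slope_eq hm]

theorem LocPL.rslope {f : Γ.Point → ℝ} (hf : LocPL f) (d : Γ.OEdge) {u : ℝ} (h0 : 0 ≤ u)
    (h1 : u < Γ.len d.1) : RSlope (fun s => f (opt d s)) u (slope f (opt d u) d) :=
  (hf.slope_spec (mem_dirs_opt d h1)).mono fun s hs => by rwa [walk_opt d h0 h1] at hs

theorem LocPL.lslope {f : Γ.Point → ℝ} (hf : LocPL f) (d : Γ.OEdge) {u : ℝ} (h0 : 0 < u)
    (h1 : u ≤ Γ.len d.1) : LSlope (fun s => f (opt d s)) u (slope f (opt d u) (rev d)) := by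
  have h := hf.rslope (rev d) (u := Γ.len d.1 - u) (by simpa using h1) (by simpa using h0)
  have e1 : opt (rev d) (Γ.len d.1 - u) = opt d u := by rw [opt_rev]; congr 1; ring
  refine Filter.Eventually.mono h fun s hs => ?_
  have e2 : opt d (u - s) = opt (rev d) (Γ.len d.1 - u + s) := by rw [opt_rev]; congr 1; ring
  simp only [e1] at hs
  show f (opt d (u - s)) = _
  rw [e2, hs]

theorem slope_opt_eq {f : Γ.Point → ℝ} {d : Γ.OEdge} {u : ℝ} {m : ℤ} (h0 : 0 ≤ u)
    (h1 : u < Γ.len d.1) (h : RSlope (fun s => f (opt d s)) u m) : slope f (opt d u) d = m :=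
  slope_eq (Filter.Eventually.mono h fun s hs => by rwa [walk_opt d h0 h1])

theorem LocPL.continuousOn {f : Γ.Point → ℝ} (hf : LocPL f) (d : Γ.OEdge) :
    ContinuousOn (fun s => f (opt d s)) (Set.Icc 0 (Γ.len d.1)) :=
  continuousOn_of_slopes (fun _ h0 h1 => ⟨_, hf.rslope d h0 h1⟩)
    fun _ h0 h1 => ⟨_, hf.lslope d h0 h1⟩

theorem ord_opt (f : Γ.Point → ℝ) (d : Γ.OEdge) {u : ℝ} (h0 : 0 < u) (h1 : u < Γ.len d.1) :
    ord f (opt d u) = slope f (opt d u) d + slope f (opt d u) (rev d) :=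
  sum_dirs_opt d h0 h1 _

theorem RationalFunction.locPL (f : Γ.RationalFunction) : LocPL f := by
  intro x d hd
  obtain ⟨u, h0, h1, rfl⟩ := exists_opt_of_mem_dirs hd
  obtain ⟨S, hS⟩ := f.piecewise_linear d.1
  rcases d with ⟨e, b⟩
  -- a punctured neighbourhood of the position of the point avoids the break points
  have hfin : ∀ c : ℝ, ∃ δ > 0, ∀ y ∈ S, y ≠ c → δ ≤ |y - c| := by
    intro c
    have hU : ((S.erase c : Finset ℝ) : Set ℝ)ᶜ ∈ 𝓝 c :=
      (S.erase c).finite_toSet.isClosed.isOpen_compl.mem_nhds (by simp)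
    obtain ⟨r, hr, hball⟩ := Metric.mem_nhds_iff.1 hU
    refine ⟨r, hr, fun y hy hne => ?_⟩
    by_contra! hlt
    exact hball (show y ∈ Metric.ball c r by rwa [Metric.mem_ball, Real.dist_eq]) (by simp [hy, hne])
  have h1 : u < Γ.len e := h1
  cases b
  · obtain ⟨δ, hδ, hs⟩ := hfin (Γ.len e - u)
    set η := min δ (Γ.len e - u) with hη
    have hη0 : 0 < η := lt_min hδ (by linarith)
    obtain ⟨m, hm⟩ := hS (Γ.len e - u - η) (Γ.len e - u) (by linarith [min_le_right δ (Γ.len e - u)])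
      (by linarith) (by linarith) (fun y hy hy' => by
        have := hs y hy hy'.2.ne
        rw [abs_of_neg (by linarith [hy'.2])] at this
        linarith [hy'.1, min_le_left δ (Γ.len e - u)])
    refine ⟨-m, eventually_of_pos hη0 fun s hs0 hs1 => ?_⟩
    rw [walk_opt _ h0 h1]
    have e1 := hm (Γ.len e - (u + s)) ⟨by linarith, by linarith⟩
    have e2 := hm (Γ.len e - u) ⟨by linarith, by linarith⟩
    simp only [opt, Bool.false_eq_true, if_false]
    rw [e1, e2]; push_cast; ring
  · obtain ⟨δ, hδ, hs⟩ := hfin u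
    set η := min δ (Γ.len e - u) with hη
    have hη0 : 0 < η := lt_min hδ (by linarith)
    obtain ⟨m, hm⟩ := hS u (u + η) h0
      (by linarith) (by linarith [min_le_right δ (Γ.len e - u)]) (fun y hy hy' => by
        have := hs y hy hy'.1.ne'
        rw [abs_of_pos (by linarith [hy'.1])] at this
        linarith [hy'.2, min_le_left δ (Γ.len e - u)])
    refine ⟨m, eventually_of_pos hη0 fun s hs0 hs1 => ?_⟩
    rw [walk_opt _ h0 h1]
    have e1 := hm (u + s) ⟨by linarith, by linarith⟩
    simp only [opt, if_true]
    rw [e1]; ring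

/-- The rational function given by a locally piecewise linear function. The break points on an edge
come from a finite cover of the edge by intervals on which the function has at most one break. -/
noncomputable def LocPL.toRF {f : Γ.Point → ℝ} (hf : LocPL f) : Γ.RationalFunction where
  toFun := f
  piecewise_linear e := by
    set L := Γ.len e with hL
    have hL0 : 0 < L := Γ.len_pos e
    have hloc : ∀ u, ∃ δ > 0, u ∈ Set.Icc 0 L →
        (∃ m : ℤ, ∀ s, u ≤ s → s ≤ u + δ → s ≤ L →
          f (Γ.edgePt e s) = f (Γ.edgePt e u) + m * (s - u)) ∧
        (∃ m : ℤ, ∀ s, u - δ ≤ s → s ≤ u → 0 ≤ s →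
          f (Γ.edgePt e s) = f (Γ.edgePt e u) + m * (s - u)) := by
      intro u
      by_cases hu : u ∈ Set.Icc 0 L
      swap
      · exact ⟨1, one_pos, fun h => absurd h hu⟩
      have hr : ∃ δ > 0, ∃ m : ℤ, ∀ s, u ≤ s → s ≤ u + δ → s ≤ L →
          f (Γ.edgePt e s) = f (Γ.edgePt e u) + m * (s - u) := by
        rcases hu.2.eq_or_lt with h | h
        · refine ⟨1, one_pos, 0, fun s h1 _ h3 => ?_⟩
          have : s = u := by linarith
          subst this; simp
        · obtain ⟨δ, hδ, -, hm⟩ := exists_pos_of_eventually (hf.rslope (e, true) hu.1 h) one_pos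
          refine ⟨δ, hδ, slope f (opt (e, true) u) (e, true), fun s h1 h2 _ => ?_⟩
          rcases h1.eq_or_lt with rfl | h1
          · simp
          have := hm (s - u) (by linarith) (by linarith)
          simp only [add_sub_cancel] at this
          rwa [opt_true] at this ⊢
      have hl : ∃ δ > 0, ∃ m : ℤ, ∀ s, u - δ ≤ s → s ≤ u → 0 ≤ s →
          f (Γ.edgePt e s) = f (Γ.edgePt e u) + m * (s - u) := by
        rcases hu.1.eq_or_lt with h | h
        · refine ⟨1, one_pos, 0, fun s h1 h2 h3 => ?_⟩
          have : s = u := by linarith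
          subst this; simp
        · obtain ⟨δ, hδ, -, hm⟩ := exists_pos_of_eventually (hf.lslope (e, true) h hu.2) one_pos
          refine ⟨δ, hδ, - slope f (opt (e, true) u) (rev (e, true)), fun s h1 h2 _ => ?_⟩
          rcases h2.eq_or_lt with rfl | h2
          · simp
          have := hm (u - s) (by linarith) (by linarith)
          simp only [opt_true, sub_sub_cancel] at this
          rw [this, opt_true]; push_cast; ring
      obtain ⟨δ, hδ, m, hm⟩ := hr
      obtain ⟨η, hη, n, hn⟩ := hl
      exact ⟨min δ η, lt_min hδ hη, fun _ =>
        ⟨⟨m, fun s h1 h2 h3 => hm s h1 (by linarith [min_le_left δ η]) h3⟩,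
          ⟨n, fun s h1 h2 h3 => hn s (by linarith [min_le_right δ η]) h2 h3⟩⟩⟩
    choose δ hδ hm using hloc
    obtain ⟨T, hT, hcov⟩ := (isCompact_Icc (a := (0 : ℝ)) (b := L)).elim_nhds_subcover
      (fun u => Set.Ioo (u - δ u) (u + δ u))
      (fun u _ => Ioo_mem_nhds (by linarith [hδ u]) (by linarith [hδ u]))
    classical
    refine ⟨T ∪ T.image (fun u => u - δ u) ∪ T.image (fun u => u + δ u), fun a b ha hab hb hS => ?_⟩
    rcases hab.eq_or_lt with rfl | hab
    · refine ⟨0, fun s hs => ?_⟩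
      have : s = a := le_antisymm hs.2 hs.1
      subst this; simp
    have hmid : (a + b) / 2 ∈ Set.Icc 0 L := ⟨by linarith, by linarith⟩
    obtain ⟨u, hu, hmem⟩ := Set.mem_iUnion₂.1 (hcov hmid)
    have h1 := hS u (by simp [hu])
    have h2 := hS (u - δ u) (by
      simp only [Finset.mem_union, Finset.mem_image]; exact Or.inl (Or.inr ⟨u, hu, rfl⟩))
    have h3 := hS (u + δ u) (by
      simp only [Finset.mem_union, Finset.mem_image]; exact Or.inr ⟨u, hu, rfl⟩)
    have hlo : u - δ u ≤ a := by by_contra! h; exact h2 ⟨h, by linarith [hmem.1]⟩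
    have hhi : b ≤ u + δ u := by by_contra! h; exact h3 ⟨by linarith [hmem.2], h⟩
    obtain ⟨⟨m, hm1⟩, ⟨n, hn1⟩⟩ := hm u (hT u hu)
    rcases le_or_gt u a with hua | hua
    · refine ⟨m, fun s hs => ?_⟩
      rw [hm1 s (by linarith [hs.1]) (by linarith [hs.2]) (by linarith [hs.2]),
        hm1 a hua (by linarith) (by linarith)]
      ring
    · have hub : b ≤ u := by by_contra! h; exact h1 ⟨hua, h⟩
      refine ⟨n, fun s hs => ?_⟩
      rw [hn1 s (by linarith [hs.1]) (by linarith [hs.2]) (by linarith [hs.1]),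
        hn1 a (by linarith) (by linarith) (by linarith)]
      ring

@[simp] theorem RationalFunction.div_apply (f : Γ.RationalFunction) (x : Γ.Point) :
    f.div x = ord f x := rfl

/-! ### Sums and maxima of rational functions -/

theorem LocPL.const (c : ℝ) : LocPL (fun _ : Γ.Point => c) :=
  fun _ _ _ => ⟨0, by simp⟩

theorem LocPL.add {f g : Γ.Point → ℝ} (hf : LocPL f) (hg : LocPL g) :
    LocPL (fun x => f x + g x) := fun x d hd => by
  obtain ⟨m, hm⟩ := hf x d hd
  obtain ⟨n, hn⟩ := hg x d hd
  exact ⟨m + n, by filter_upwards [hm, hn] with s h1 h2; rw [h1, h2]; push_cast; ring⟩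

theorem LocPL.neg {f : Γ.Point → ℝ} (hf : LocPL f) : LocPL (fun x => -f x) := fun x d hd => by
  obtain ⟨m, hm⟩ := hf x d hd
  exact ⟨-m, by filter_upwards [hm] with s h1; rw [h1]; push_cast; ring⟩

theorem LocPL.sub {f g : Γ.Point → ℝ} (hf : LocPL f) (hg : LocPL g) :
    LocPL (fun x => f x - g x) := by
  simpa [sub_eq_add_neg] using hf.add hg.neg

/-- Where one of two rational functions is larger, it stays larger for a while. -/
theorem LocPL.eventually_lt {f g : Γ.Point → ℝ} (hf : LocPL f) (hg : LocPL g) {x : Γ.Point}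
    {d : Γ.OEdge} (hd : d ∈ dirs x) (h : f x < g x) :
    ∀ᶠ s in 𝓝[>] (0 : ℝ), f (walk x d s) < g (walk x d s) := by
  have h1 : ∀ᶠ s in 𝓝[>] (0 : ℝ), f x + slope f x d * s < g x + slope g x d * s := by
    refine eventually_nhdsWithin_of_eventually_nhds ?_
    refine ContinuousAt.eventually_lt (by fun_prop) (by fun_prop) (by simpa using h)
  filter_upwards [h1, hf.slope_spec hd, hg.slope_spec hd] with s h1 h2 h3
  rwa [h2, h3]

theorem LocPL.max {f g : Γ.Point → ℝ} (hf : LocPL f) (hg : LocPL g) :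
    LocPL (fun x => max (f x) (g x)) := fun x d hd => by
  rcases lt_trichotomy (f x) (g x) with h | h | h
  · refine ⟨slope g x d, ?_⟩
    filter_upwards [hf.eventually_lt hg hd h, hg.slope_spec hd] with s h1 h2
    rw [max_eq_right h1.le, max_eq_right h.le, h2]
  · refine ⟨Max.max (slope f x d) (slope g x d), ?_⟩
    filter_upwards [hf.slope_spec hd, hg.slope_spec hd, self_mem_nhdsWithin] with s h1 h2 h3
    have h3 : 0 < s := h3
    rw [h1, h2, h, max_self, max_add_add_left, ← max_mul_of_nonneg _ _ h3.le]
    push_cast; rfl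
  · refine ⟨slope f x d, ?_⟩
    filter_upwards [hg.eventually_lt hf hd h, hf.slope_spec hd] with s h1 h2
    rw [max_eq_left h1.le, max_eq_left h.le, h2]

theorem ord_const (c : ℝ) (x : Γ.Point) : ord (fun _ => c) x = 0 :=
  Finset.sum_eq_zero fun d _ => slope_eq (by simp)

theorem ord_add {f g : Γ.Point → ℝ} (hf : LocPL f) (hg : LocPL g) (x : Γ.Point) :
    ord (fun x => f x + g x) x = ord f x + ord g x := by
  rw [ord, ord, ord, ← Finset.sum_add_distrib]
  refine Finset.sum_congr rfl fun d hd => slope_eq ?_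
  filter_upwards [hf.slope_spec hd, hg.slope_spec hd] with s h1 h2
  rw [h1, h2]; push_cast; ring

theorem ord_neg {f : Γ.Point → ℝ} (hf : LocPL f) (x : Γ.Point) :
    ord (fun x => -f x) x = -ord f x := by
  rw [ord, ord, ← Finset.sum_neg_distrib]
  refine Finset.sum_congr rfl fun d hd => slope_eq ?_
  filter_upwards [hf.slope_spec hd] with s h1
  rw [h1]; push_cast; ring

theorem ord_sub {f g : Γ.Point → ℝ} (hf : LocPL f) (hg : LocPL g) (x : Γ.Point) :
    ord (fun x => f x - g x) x = ord f x - ord g x := by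
  have := ord_add hf hg.neg x
  rw [ord_neg hg] at this
  simpa [sub_eq_add_neg] using this

theorem slope_le_slope {f g : Γ.Point → ℝ} (hf : LocPL f) (hg : LocPL g) {x : Γ.Point}
    {d : Γ.OEdge} (hd : d ∈ dirs x) (hx : f x = g x)
    (h : ∀ᶠ s in 𝓝[>] (0 : ℝ), f (walk x d s) ≤ g (walk x d s)) : slope f x d ≤ slope g x d := by
  obtain ⟨s, ⟨⟨h1, h2⟩, h3⟩, h4⟩ := (((hf.slope_spec hd).and (hg.slope_spec hd)).and h |>.and
    (self_mem_nhdsWithin : Set.Ioi (0 : ℝ) ∈ 𝓝[>] (0 : ℝ))).exists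
  have h4 : 0 < s := h4
  rw [h1, h2, hx] at h3
  have : (slope f x d : ℝ) * s ≤ slope g x d * s := by linarith
  exact_mod_cast le_of_mul_le_mul_right this h4

theorem ord_le_ord {f g : Γ.Point → ℝ} (hf : LocPL f) (hg : LocPL g) {x : Γ.Point}
    (hx : f x = g x) (h : ∀ y, f y ≤ g y) : ord f x ≤ ord g x :=
  Finset.sum_le_sum fun _ hd => slope_le_slope hf hg hd hx (Eventually.of_forall fun _ => h _)

theorem le_ord_max {f g : Γ.Point → ℝ} (hf : LocPL f) (hg : LocPL g) {x : Γ.Point} {c : ℤ}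
    (h1 : c ≤ ord f x) (h2 : c ≤ ord g x) : c ≤ ord (fun y => Max.max (f y) (g y)) x := by
  rcases le_total (f x) (g x) with h | h
  · exact h2.trans (ord_le_ord hg (hf.max hg) (max_eq_right h).symm fun y => le_max_right _ _)
  · exact h1.trans (ord_le_ord hf (hf.max hg) (max_eq_left h).symm fun y => le_max_left _ _)

end Germs

/-! ### Principal divisors have degree zero, and the slopes of functions in `R(D)` are bounded -/

theorem LSlope.unique {φ : ℝ → ℝ} {u m n : ℝ} (h : LSlope φ u m) (h' : LSlope φ u n) : m = n := by
  obtain ⟨s, ⟨h1, h2⟩, h3⟩ :=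
    ((h.and h').and (self_mem_nhdsWithin : Set.Ioi (0 : ℝ) ∈ 𝓝[>] (0 : ℝ))).exists
  have h3 : 0 < s := h3
  have : m * s = n * s := by linarith
  exact mul_right_cancel₀ h3.ne' this

/-- A function without break points inside `(a, b)` is linear. -/
theorem slope_add_slope_eq_zero {φ : ℝ → ℝ} {a b : ℝ} {r l : ℝ → ℤ} (hab : a < b)
    (hr : ∀ u, a ≤ u → u < b → RSlope φ u (r u)) (hl : ∀ u, a < u → u ≤ b → LSlope φ u (l u))
    (h : ∀ u, a < u → u < b → r u + l u = 0) : r a + l b = 0 := by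
  have hc := continuousOn_of_slopes (fun u h1 h2 => ⟨_, hr u h1 h2⟩) (fun u h1 h2 => ⟨_, hl u h1 h2⟩)
  have h0 : ∀ u, a < u → u < b → (r u + l u : ℝ) = 0 := fun u h1 h2 => by exact_mod_cast h u h1 h2
  have h1 : LocConvexOn φ a b :=
    ⟨hc, fun u h1 h2 => ⟨r u, l u, hr u h1.le h2, hl u h1 h2.le, (h0 u h1 h2).ge⟩⟩
  have h2 : LocConvexOn (fun x => -φ x) a b :=
    ⟨hc.neg, fun u h1 h2 => ⟨-r u, -l u, (hr u h1.le h2).mono fun s hs => by simp only [hs]; ring,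
      (hl u h1 h2.le).mono fun s hs => by simp only [hs]; ring, by linarith [h0 u h1 h2]⟩⟩
  have h3 : ∀ t ∈ Set.Icc a b, φ t = φ a + r a * (t - a) := fun t ht => by
    have e1 := h1.tangent_le (hr a le_rfl hab) ht
    have e2 := h2.tangent_le (m := -r a)
      ((hr a le_rfl hab).mono fun s hs => by simp only [hs]; ring) ht
    linarith
  have h4 : LSlope φ b (-r a) := eventually_of_pos (δ := b - a) (by linarith) fun s hs hs' => by
    rw [h3 (b - s) ⟨by linarith, by linarith⟩, h3 b ⟨hab.le, le_rfl⟩]; ring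
  have h5 := (hl b hab le_rfl).unique h4
  have h6 : (r a : ℝ) + l b = 0 := by linarith
  exact_mod_cast h6

theorem sum_slopes_eq {φ : ℝ → ℝ} {a : ℝ} {r l : ℝ → ℤ} (S : Finset ℝ) :
    ∀ b, a < b → (∀ u, a ≤ u → u < b → RSlope φ u (r u)) →
      (∀ u, a < u → u ≤ b → LSlope φ u (l u)) → (∀ u ∈ S, a < u ∧ u < b) →
      (∀ u, a < u → u < b → u ∉ S → r u + l u = 0) → ∑ u ∈ S, (r u + l u) = -r a - l b := by
  induction S using Finset.induction_on_max with
  | empty =>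
    intro b hab hr hl _ h
    have := slope_add_slope_eq_zero hab hr hl fun u h1 h2 => h u h1 h2 (by simp)
    simp only [Finset.sum_empty]; linarith
  | insert c S hc ih =>
    intro b hab hr hl hS h
    obtain ⟨hac, hcb⟩ := hS c (by simp)
    have h1 := ih c hac (fun u h1 h2 => hr u h1 (h2.trans hcb))
      (fun u h1 h2 => hl u h1 (h2.trans hcb.le))
      (fun u hu => ⟨(hS u (by simp [hu])).1, hc u hu⟩)
      (fun u h1 h2 h3 => h u h1 (h2.trans hcb) (by simp [h3, h2.ne]))
    have h2 := slope_add_slope_eq_zero hcb (fun u h1 h2 => hr u (hac.le.trans h1) h2)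
      (fun u h1 h2 => hl u (hac.trans h1) h2)
      (fun u h1 h2 => h u (hac.trans h1) h2 (by
        simp only [Finset.mem_insert, not_or]
        exact ⟨h1.ne', fun hu => absurd (hc u hu) (by linarith)⟩))
    rw [Finset.sum_insert (fun hmem => lt_irrefl c (hc c hmem)), h1]
    linarith

section Degree

variable {Γ : WeightedGraph.{u, v}}

open Classical in
/-- The degree of a divisor, sorted by vertices and edges. -/
theorem exists_degree_eq (D : Γ.Divisor) : ∃ S : Γ.E → Finset ℝ,
    (∀ e, ∀ t ∈ S e, 0 < t ∧ t < Γ.len e) ∧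
    (∀ e t, 0 < t → t < Γ.len e → t ∉ S e → D (opt (e, true) t) = 0) ∧
    D.degree = ∑ v, D (.vertex v) + ∑ e, ∑ t ∈ S e, D (opt (e, true) t) := by
  let c : Γ.Point → Option Γ.E := fun x => match x with
    | .vertex _ => none
    | .inner e _ => some e
  let pos : Γ.Point → ℝ := fun x => match x with
    | .vertex _ => 0
    | .inner _ t => t
  have hc : ∀ (x : Γ.Point) (e : Γ.E), c x = some e →
      (0 < pos x ∧ pos x < Γ.len e) ∧ opt (e, true) (pos x) = x := by
    rintro (v | ⟨e', t⟩) e h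
    · simp [c] at h
    · simp only [c, Option.some.injEq] at h
      subst h
      exact ⟨t.2, (inner_eq_opt _ t).symm⟩
  refine ⟨fun e => (D.support.filter (fun x => c x = some e)).image pos, ?_, ?_, ?_⟩
  · intro e t ht
    obtain ⟨x, hx, rfl⟩ := Finset.mem_image.1 ht
    exact (hc x e (Finset.mem_filter.1 hx).2).1
  · intro e t h0 h1 ht
    by_contra hne
    apply ht
    refine Finset.mem_image.2 ⟨opt (e, true) t, Finset.mem_filter.2 ⟨by simpa using hne, ?_⟩, ?_⟩
    · rw [opt_inner _ h0 h1]
    · rw [opt_inner _ h0 h1]; simp [pos]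
  · rw [Finsupp.degree_apply, ← Finset.sum_fiberwise D.support c, Fintype.sum_option]
    congr 1
    · rw [← Finset.sum_image (s := Finset.univ) (g := (Point.vertex : Γ.V → Γ.Point)) (f := D)
        (fun a _ b _ h => Point.vertex.inj h)]
      refine Finset.sum_subset ?_ ?_
      · intro x hx
        rcases x with v | ⟨e, t⟩
        · simp
        · simp [c] at hx
      · intro x hx hx'
        obtain ⟨v, -, rfl⟩ := Finset.mem_image.1 hx
        by_contra hne
        exact hx' (Finset.mem_filter.2 ⟨by simpa using hne, rfl⟩)
    · refine Finset.sum_congr rfl fun e _ => ?_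
      rw [Finset.sum_image]
      · refine Finset.sum_congr rfl fun x hx => ?_
        rw [(hc x e (Finset.mem_filter.1 hx).2).2]
      · intro x hx y hy h
        rw [← (hc x e (Finset.mem_filter.1 hx).2).2, ← (hc y e (Finset.mem_filter.1 hy).2).2, h]

open Classical in
/-- Sums over all directions at all vertices are sums over all oriented edges. -/
theorem sum_vertices_dirs (F : Γ.Point → Γ.OEdge → ℤ) :
    ∑ v, ∑ d ∈ dirs (.vertex v), F (.vertex v) d =
      ∑ e : Γ.E, (F (opt (e, true) 0) (e, true) + F (opt (e, false) 0) (e, false)) := by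
  have h1 : ∀ v : Γ.V, ∑ d ∈ dirs (.vertex v), F (.vertex v) d =
      ∑ d : Γ.OEdge with start d = v, F (opt d 0) d := fun v => by
    refine Finset.sum_congr rfl fun d hd => ?_
    rw [opt_zero, mem_dirs_vertex.1 hd]
  rw [Finset.sum_congr rfl fun v _ => h1 v,
    Finset.sum_fiberwise Finset.univ start fun d : Γ.OEdge => F (opt d 0) d, Fintype.sum_prod_type]
  exact Finset.sum_congr rfl fun e _ => by rw [Fintype.sum_bool]

theorem degree_div (f : Γ.RationalFunction) : f.div.degree = 0 := by
  classical
  obtain ⟨S, hS, hS', hdeg⟩ := exists_degree_eq f.div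
  simp only [RationalFunction.div_apply] at hS' hdeg
  have hv : ∑ v, ord f (.vertex v) = _ := sum_vertices_dirs (fun x d => slope f x d)
  rw [hdeg, hv, ← Finset.sum_add_distrib]
  refine Finset.sum_eq_zero fun e _ => ?_
  have hrev : rev ((e, true) : Γ.OEdge) = (e, false) := rfl
  have hord : ∀ u, 0 < u → u < Γ.len e → ord f (opt (e, true) u) =
      slope f (opt (e, true) u) (e, true) + slope f (opt (e, true) u) (e, false) :=
    fun u h1 h2 => by rw [ord_opt _ _ h1 h2, hrev]
  have h := sum_slopes_eq (φ := fun s => f (opt (e, true) s)) (a := 0)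
    (r := fun u => slope f (opt (e, true) u) (e, true))
    (l := fun u => slope f (opt (e, true) u) (e, false)) (S e) (Γ.len e) (Γ.len_pos e)
    (fun u h1 h2 => f.locPL.rslope (e, true) h1 h2)
    (fun u h1 h2 => f.locPL.lslope (e, true) h1 h2) (hS e)
    (fun u h1 h2 h3 => by rw [← hord u h1 h2, hS' e u h1 h2 h3])
  rw [Finset.sum_congr rfl fun u hu => hord u (hS e u hu).1 (hS e u hu).2, h]
  have h0 : opt ((e, false) : Γ.OEdge) 0 = opt (e, true) (Γ.len e) := by
    rw [opt_zero, opt_len ((e, true) : Γ.OEdge)]; rfl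
  rw [h0]; ring

theorem degree_nonneg_of_nonneg {D : Γ.Divisor} (hD : ∀ x, 0 ≤ D x) : 0 ≤ D.degree := by
  rw [Finsupp.degree_apply]; exact Finset.sum_nonneg fun x _ => hD x

theorem apply_le_degree {D : Γ.Divisor} (hD : ∀ x, 0 ≤ D x) (x : Γ.Point) : D x ≤ D.degree := by
  rw [Finsupp.degree_apply]
  by_cases hx : x ∈ D.support
  · exact Finset.single_le_sum (fun y _ => hD y) hx
  · rw [Finsupp.notMem_support_iff.1 hx]; exact Finset.sum_nonneg fun y _ => hD y

/-- Truncating `f` from below at the level `f x` leaves it in `R(D)`, so that the slope in question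
is at most the coefficient at `x` of an effective divisor of degree `deg D`. -/
theorem slope_le_degree {D : Γ.Divisor} (hD : ∀ x, 0 ≤ D x) {f : Γ.Point → ℝ} (hf : LocPL f)
    (h : ∀ x, 0 ≤ D x + ord f x) {x : Γ.Point} {d : Γ.OEdge} (hd : d ∈ dirs x) :
    slope f x d ≤ D.degree := by
  have hc := LocPL.const (Γ := Γ) (f x)
  have hg := hf.max hc
  have hE : ∀ y, 0 ≤ (D + hg.toRF.div) y := fun y => by
    have := le_ord_max hf hc (x := y) (c := -D y) (by linarith [h y])
      (by rw [ord_const]; linarith [hD y])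
    have h2 : (D + hg.toRF.div) y = D y + ord (fun y => max (f y) (f x)) y := rfl
    linarith
  have h1 := apply_le_degree hE x
  rw [map_add, degree_div, add_zero] at h1
  have h2 : (D + hg.toRF.div) x = D x + ord (fun y => max (f y) (f x)) x := rfl
  have hmx : max (f x) (f x) = f x := max_self _
  have h3 : slope f x d ≤ slope (fun y => max (f y) (f x)) x d :=
    slope_le_slope hf hg hd hmx.symm (Eventually.of_forall fun s => le_max_left _ _)
  have h4 : slope (fun y => max (f y) (f x)) x d ≤ ord (fun y => max (f y) (f x)) x := by
    refine Finset.single_le_sum (f := fun d => slope (fun y => max (f y) (f x)) x d)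
      (fun d' hd' => ?_) hd
    have := slope_le_slope hc hg hd' hmx.symm (Eventually.of_forall fun s => le_max_right _ _)
    rwa [slope_eq (m := 0) (by simp)] at this
  linarith [hD x]

theorem neg_degree_le_slope {D : Γ.Divisor} (hD : ∀ x, 0 ≤ D x) {f : Γ.Point → ℝ} (hf : LocPL f)
    (h : ∀ x, 0 ≤ D x + ord f x) {x : Γ.Point} {d : Γ.OEdge} (hd : d ∈ dirs x) :
    -D.degree ≤ slope f x d := by
  obtain ⟨u, h0, h1, rfl⟩ := exists_opt_of_mem_dirs hd
  obtain ⟨δ, hδ, hδ', hs⟩ := exists_pos_of_eventually (hf.rslope d h0 h1)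
    (b := Γ.len d.1 - u) (by linarith)
  have h2 := hf.lslope d (u := u + δ) (by linarith) (by linarith)
  have h3 : LSlope (fun s => f (opt d s)) (u + δ) (-slope f (opt d u) d) := by
    refine eventually_of_pos hδ fun s hs0 hsδ => ?_
    have e1 := hs δ hδ le_rfl
    have e2 := hs (δ - s) (by linarith) (by linarith)
    rw [e1, show u + δ - s = u + (δ - s) by ring, e2]; ring
  have h4 := h2.unique h3
  have h5 : slope f (opt d (u + δ)) (rev d) ≤ D.degree := by
    refine slope_le_degree hD hf h ?_
    rw [opt_inner d (by linarith) (by linarith), mem_dirs_inner]; rfl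
  have h6 : slope f (opt d (u + δ)) (rev d) = -slope f (opt d u) d := by exact_mod_cast h4
  linarith

theorem LocPL.lipschitz {f : Γ.Point → ℝ} (hf : LocPL f) {C : ℤ}
    (hC : ∀ x, ∀ d ∈ dirs x, slope f x d ≤ C) (d : Γ.OEdge) {s t : ℝ} (hs : 0 ≤ s) (hst : s ≤ t)
    (ht : t ≤ Γ.len d.1) : f (opt d t) ≤ f (opt d s) + C * (t - s) :=
  le_of_rslope_le (φ := fun s => f (opt d s)) hst
    ((hf.continuousOn d).mono (Set.Icc_subset_Icc hs ht)) fun u h0 h1 =>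
    ⟨_, by exact_mod_cast hC _ _ (mem_dirs_opt d (h1.trans_le ht)),
      hf.rslope d (hs.trans h0) (h1.trans_le ht)⟩

theorem Connected.rel_of_edges (hΓ : Γ.Connected) {r : Γ.V → Γ.V → Prop} (hr : Equivalence r)
    (h : ∀ e, r (Γ.src e) (Γ.tgt e)) (a b : Γ.V) : r a b := by
  induction hΓ.2 a b with
  | rel x y hxy => obtain ⟨e, rfl, rfl⟩ := hxy; exact h e
  | refl x => exact hr.refl x
  | symm x y _ ih => exact hr.symm ih
  | trans x y z _ _ h1 h2 => exact hr.trans h1 h2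

theorem Point.exists_opt (x : Γ.Point) :
    (∃ v, x = .vertex v) ∨ ∃ d : Γ.OEdge, ∃ u, 0 < u ∧ u < Γ.len d.1 ∧ x = opt d u := by
  rcases x with v | ⟨e, t⟩
  · exact Or.inl ⟨v, rfl⟩
  · exact Or.inr ⟨(e, true), t, t.2.1, t.2.2, inner_eq_opt e t⟩

theorem eq_of_slopes_nonpos (hΓ : Γ.Connected) {f : Γ.Point → ℝ} (hf : LocPL f)
    (h : ∀ x, ∀ d ∈ dirs x, slope f x d ≤ 0) (x y : Γ.Point) : f x = f y := by
  have hedge : ∀ (d : Γ.OEdge) (s : ℝ), 0 ≤ s → s ≤ Γ.len d.1 → f (opt d s) ≤ f (opt d 0) := by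
    intro d s h0 h1
    have := hf.lipschitz (C := 0) h d le_rfl h0 h1
    simpa using this
  have hedge' : ∀ (d : Γ.OEdge) (s : ℝ), 0 ≤ s → s ≤ Γ.len d.1 →
      f (opt d s) = f (.vertex (start d)) := by
    intro d s h0 h1
    rw [← opt_zero]
    refine le_antisymm (hedge d s h0 h1) ?_
    have e1 := hf.lipschitz (C := 0) h (rev d) (s := Γ.len d.1 - s) (t := Γ.len d.1)
      (by linarith) (by linarith) (by simp)
    rw [opt_rev, opt_rev] at e1
    simpa using e1
  have hv : ∀ a b : Γ.V, f (.vertex a) = f (.vertex b) := by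
    refine hΓ.rel_of_edges ⟨fun _ => rfl, fun h => h.symm, fun h1 h2 => h1.trans h2⟩ fun e => ?_
    have := hedge' (e, true) (Γ.len e) (Γ.len_pos e).le le_rfl
    rw [show opt ((e, true) : Γ.OEdge) (Γ.len e) = _ from opt_len ((e, true) : Γ.OEdge)] at this
    simpa [start, finish, rev] using this.symm
  have hp : ∀ x, ∃ v, f x = f (.vertex v) := by
    intro x
    rcases x.exists_opt with ⟨v, rfl⟩ | ⟨d, u, h0, h1, rfl⟩
    · exact ⟨v, rfl⟩
    · exact ⟨_, hedge' d u h0.le h1.le⟩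
  obtain ⟨a, ha⟩ := hp x
  obtain ⟨b, hb⟩ := hp y
  rw [ha, hb, hv a b]

theorem eq_of_ord_eq_zero (hΓ : Γ.Connected) {f : Γ.Point → ℝ} (hf : LocPL f)
    (h : ∀ x, ord f x = 0) (x y : Γ.Point) : f x = f y :=
  eq_of_slopes_nonpos hΓ hf (fun x d hd => by
    have := slope_le_degree (D := 0) (fun _ => le_rfl) hf (fun x => by simp [h x]) hd
    simpa using this) x y

end Degree

/-! ### Models of a metric graph -/

section Models

universe u₁ v₁ u₂ v₂

variable {Γ : WeightedGraph.{u, v}} {H : WeightedGraph.{w, z}} {K : WeightedGraph.{u₁, v₁}}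

theorem mem_dirs_of_opt {x : Γ.Point} {d : Γ.OEdge} {u : ℝ} (h : x = opt d u)
    (h1 : u < Γ.len d.1) : d ∈ dirs x := h ▸ mem_dirs_opt d h1

theorem edgePt_of_nonpos (e : Γ.E) {s : ℝ} (h : s ≤ 0) : Γ.edgePt e s = .vertex (Γ.src e) :=
  dif_pos h

theorem edgePt_of_len_le (e : Γ.E) {s : ℝ} (h : Γ.len e ≤ s) :
    Γ.edgePt e s = .vertex (Γ.tgt e) := by
  rw [edgePt, dif_neg (by linarith [Γ.len_pos e]), dif_neg h.not_gt]

theorem edgePt_of_mem (e : Γ.E) {s : ℝ} (h : s ∈ Set.Ioo 0 (Γ.len e)) :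
    Γ.edgePt e s = .inner e ⟨s, h⟩ := edgePt_inner e ⟨s, h⟩

/-- The inverse of an isometry. -/
noncomputable def MetricIso.symm (φ : MetricIso H Γ) : MetricIso Γ H where
  toEquiv := φ.toEquiv.symm
  local_isometry y := by
    obtain ⟨x, rfl⟩ := φ.toEquiv.surjective y
    obtain ⟨σ, hσ, h⟩ := φ.local_isometry x
    have hx : φ.toEquiv.symm (φ.toEquiv x) = x := φ.toEquiv.symm_apply_apply x
    by_cases hE : Nonempty H.OEdge
    · refine ⟨Function.invFunOn σ (dirs x), ?_, fun d hd => ?_⟩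
      · show Set.BijOn _ _ (dirs (φ.toEquiv.symm (φ.toEquiv x)) : Set H.OEdge)
        rw [hx]
        exact hσ.symm hσ.invOn_invFunOn.symm
      · have hd' := hσ.invOn_invFunOn.2 hd
        have hm : Function.invFunOn σ (dirs x) d ∈ dirs x :=
          (hσ.symm hσ.invOn_invFunOn.symm).mapsTo hd
        filter_upwards [h _ hm] with s hs
        show φ.toEquiv.symm (walk (φ.toEquiv x) d s) = walk (φ.toEquiv.symm (φ.toEquiv x)) _ s
        rw [hx, Equiv.symm_apply_eq]
        rw [hd'] at hs
        exact hs.symm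
    · -- without edges there are no directions at all
      have hemp : IsEmpty Γ.OEdge := by
        refine ⟨fun d => ?_⟩
        obtain ⟨x', hx'⟩ := φ.toEquiv.surjective (opt d 0)
        obtain ⟨σ', hσ', -⟩ := φ.local_isometry x'
        have hd : d ∈ dirs (φ.toEquiv x') := mem_dirs_of_opt hx' (Γ.len_pos _)
        obtain ⟨d₁, -, -⟩ := hσ'.surjOn hd
        exact hE ⟨d₁⟩
      refine ⟨fun d => hemp.elim d, ⟨fun d => hemp.elim d, fun d => hemp.elim d, fun d _ => ?_⟩,
        fun d => hemp.elim d⟩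
      exact absurd ⟨d⟩ hE

/-- The composition of two isometries. -/
def MetricIso.trans (φ : MetricIso K H) (ψ : MetricIso H Γ) : MetricIso K Γ where
  toEquiv := φ.toEquiv.trans ψ.toEquiv
  local_isometry x := by
    obtain ⟨σ, hσ, h⟩ := φ.local_isometry x
    obtain ⟨τ, hτ, h'⟩ := ψ.local_isometry (φ.toEquiv x)
    refine ⟨τ ∘ σ, hτ.comp hσ, fun d hd => ?_⟩
    filter_upwards [h d hd, h' (σ d) (hσ.mapsTo hd)] with s h1 h2
    have h1 : φ.toEquiv (walk x d s) = walk (φ.toEquiv x) (σ d) s := h1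
    show ψ.toEquiv (φ.toEquiv (walk x d s)) = _
    rw [h1]; exact h2

theorem LocPL.comp {f : Γ.Point → ℝ} (hf : LocPL f) (φ : MetricIso H Γ) :
    LocPL (fun x => f (φ.toEquiv x)) := fun x d hd => by
  obtain ⟨σ, hσ, h⟩ := φ.local_isometry x
  obtain ⟨m, hm⟩ := hf (φ.toEquiv x) (σ d) (hσ.mapsTo hd)
  refine ⟨m, ?_⟩
  filter_upwards [h d hd, hm] with s h1 h2
  rw [← h2]; exact congrArg f h1

theorem MetricIso.exists_slope_eq (φ : MetricIso H Γ) (x : H.Point) :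
    ∃ σ : H.OEdge → Γ.OEdge, Set.BijOn σ (dirs x) (dirs (φ.toEquiv x)) ∧
      ∀ d ∈ dirs x, ∀ f : Γ.Point → ℝ, LocPL f →
        slope (fun x => f (φ.toEquiv x)) x d = slope f (φ.toEquiv x) (σ d) := by
  obtain ⟨σ, hσ, h⟩ := φ.local_isometry x
  refine ⟨σ, hσ, fun d hd f hf => slope_eq ?_⟩
  filter_upwards [h d hd, hf.slope_spec (hσ.mapsTo hd)] with s h1 h2
  exact (congrArg f h1).trans h2

theorem ord_comp {f : Γ.Point → ℝ} (hf : LocPL f) (φ : MetricIso H Γ) (x : H.Point) :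
    ord (fun x => f (φ.toEquiv x)) x = ord f (φ.toEquiv x) := by
  obtain ⟨σ, hσ, h⟩ := φ.exists_slope_eq x
  rw [ord, ord]
  exact Finset.sum_nbij σ hσ.mapsTo hσ.injOn hσ.surjOn fun d hd => h d hd f hf

theorem MetricIso.deg_eq (φ : MetricIso H Γ) (x : H.Point) : deg (φ.toEquiv x) = deg x := by
  obtain ⟨σ, hσ, -⟩ := φ.local_isometry x
  exact (Finset.card_nbij σ hσ.mapsTo hσ.injOn hσ.surjOn).symm

theorem deg_inner (e : Γ.E) (t : Set.Ioo (0 : ℝ) (Γ.len e)) : deg (.inner e t) = 2 := by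
  have := dirs_inner e t (fun _ => 1)
  simp only [Finset.sum_const, nsmul_eq_mul, mul_one] at this
  rw [deg]; exact_mod_cast this

theorem sum_deg_vertices : ∑ v : Γ.V, (deg (.vertex v : Γ.Point) : ℤ) = 2 * Fintype.card Γ.E := by
  have := sum_vertices_dirs (Γ := Γ) (fun _ _ => 1)
  simp only [Finset.sum_const, nsmul_eq_mul, mul_one] at this
  rw [show ∑ v : Γ.V, (deg (.vertex v : Γ.Point) : ℤ) = _ from this]
  simp [mul_comm]

/-- The genus in terms of the degrees of the points: inner points of edges do not contribute. -/
theorem sum_deg_sub_two (S : Finset Γ.Point) (hS : ∀ v, Point.vertex v ∈ S) :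
    ∑ x ∈ S, ((deg x : ℤ) - 2) = 2 * Γ.genus - 2 := by
  classical
  have h1 : ∑ x ∈ Finset.univ.image (Point.vertex : Γ.V → Γ.Point), ((deg x : ℤ) - 2) =
      ∑ x ∈ S, ((deg x : ℤ) - 2) := by
    refine Finset.sum_subset (fun x hx => ?_) (fun x _ hx => ?_)
    · obtain ⟨v, -, rfl⟩ := Finset.mem_image.1 hx
      exact hS v
    · rcases x with v | ⟨e, t⟩
      · simp at hx
      · rw [deg_inner]; norm_num
  rw [← h1, Finset.sum_image (fun a _ b _ h => Point.vertex.inj h), Finset.sum_sub_distrib,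
    sum_deg_vertices, genus]
  simp only [Finset.sum_const, Finset.card_univ, nsmul_eq_mul]
  ring

open Classical in
theorem MetricIso.genus_eq (φ : MetricIso H Γ) : H.genus = Γ.genus := by
  let S : Finset H.Point := Finset.univ.image Point.vertex ∪
    Finset.univ.image fun v => φ.toEquiv.symm (.vertex v)
  have h1 := sum_deg_sub_two S fun v => by simp [S]
  have h2 := sum_deg_sub_two (S.map φ.toEquiv.toEmbedding) fun v => by
    refine Finset.mem_map.2 ⟨φ.toEquiv.symm (.vertex v), by simp [S], by simp⟩
  rw [Finset.sum_map] at h2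
  have h3 : ∑ x ∈ S, ((deg (φ.toEquiv.toEmbedding x) : ℤ) - 2) = ∑ x ∈ S, ((deg x : ℤ) - 2) :=
    Finset.sum_congr rfl fun x _ => by
      show ((deg (φ.toEquiv x) : ℤ) - 2) = _
      rw [φ.deg_eq x]
  linarith

open Classical in
/-- A bijection that maps every edge isometrically into an edge is an isometry if the genera agree:
it is injective on directions, so the degrees can only increase, and the genus controls their
sum. -/
noncomputable def MetricIso.ofEdges (φ : H.Point ≃ Γ.Point) (hg : H.genus = Γ.genus)
    (he : ∀ e : H.E, ∃ d : Γ.OEdge, ∃ c, 0 ≤ c ∧ c + H.len e ≤ Γ.len d.1 ∧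
      ∀ s, 0 ≤ s → s ≤ H.len e → φ (opt (e, true) s) = opt d (c + s)) : MetricIso H Γ where
  toEquiv := φ
  local_isometry := by
    have he' : ∀ d : H.OEdge, ∃ d' : Γ.OEdge, ∃ c, 0 ≤ c ∧ c + H.len d.1 ≤ Γ.len d'.1 ∧
        ∀ s, 0 ≤ s → s ≤ H.len d.1 → φ (opt d s) = opt d' (c + s) := by
      rintro ⟨e, b⟩
      obtain ⟨d', c, h0, h1, h⟩ := he e
      cases b
      · refine ⟨rev d', Γ.len d'.1 - c - H.len e, by linarith, by simpa using h0, fun s h2 h3 => ?_⟩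
        have h3 : s ≤ H.len e := h3
        have e1 : opt (e, false) s = opt (e, true) (H.len e - s) := opt_rev (e, true) s
        rw [e1, h _ (by linarith) (by linarith), opt_rev]; congr 1; ring
      · exact ⟨d', c, h0, h1, h⟩
    choose σ c hc0 hc1 hσ using he'
    have hx : ∀ x, ∀ d ∈ dirs x, σ d ∈ dirs (φ x) ∧
        ∃ δ > 0, ∀ s, 0 ≤ s → s < δ → φ (walk x d s) = walk (φ x) (σ d) s := by
      intro x d hd
      obtain ⟨u, h0, h1, rfl⟩ := exists_opt_of_mem_dirs hd
      rw [hσ d u h0 h1.le]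
      have h2 : c d + u < Γ.len (σ d).1 := by linarith [hc1 d]
      refine ⟨mem_dirs_opt _ h2, H.len d.1 - u, by linarith, fun s h3 h4 => ?_⟩
      rw [walk_opt d h0 h1, walk_opt _ (by linarith [hc0 d]) h2, hσ _ _ (by linarith) (by linarith),
        add_assoc]
    have hinj : ∀ x : H.Point, Set.InjOn σ (dirs x) := by
      intro x d hd d' hd' hdd
      obtain ⟨-, δ, hδ, h1⟩ := hx x d hd
      obtain ⟨-, δ', hδ', h2⟩ := hx x d' hd'
      obtain ⟨u, hu0, hu1, rfl⟩ := exists_opt_of_mem_dirs hd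
      obtain ⟨u', hu0', hu1', hu'⟩ := exists_opt_of_mem_dirs hd'
      -- the segments in the directions `d` and `d'` agree at small distances
      have key : ∀ s, 0 ≤ s → s < δ → s < δ' → opt d (u + s) = opt d' (u' + s) := by
        intro s h0 h3 h4
        rw [← walk_opt d hu0 hu1, ← walk_opt d' hu0' hu1', ← hu']
        apply φ.injective
        rw [h1 s h0 h3, h2 s h0 h4, hdd]
      set s := min (min δ δ') (min (H.len d.1 - u) (H.len d'.1 - u')) / 2 with hs
      have hm : 0 < min (min δ δ') (min (H.len d.1 - u) (H.len d'.1 - u')) :=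
        lt_min (lt_min hδ hδ') (lt_min (by linarith) (by linarith))
      have hs0 : 0 < s := by positivity
      have hs1 : s < δ := by
        linarith [min_le_left (min δ δ') (min (H.len d.1 - u) (H.len d'.1 - u')), min_le_left δ δ']
      have hs2 : s < δ' := by
        linarith [min_le_left (min δ δ') (min (H.len d.1 - u) (H.len d'.1 - u')), min_le_right δ δ']
      have hs3 : s < H.len d.1 - u := by
        linarith [min_le_right (min δ δ') (min (H.len d.1 - u) (H.len d'.1 - u')),
          min_le_left (H.len d.1 - u) (H.len d'.1 - u')]
      have hs4 : s < H.len d'.1 - u' := by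
        linarith [min_le_right (min δ δ') (min (H.len d.1 - u) (H.len d'.1 - u')),
          min_le_right (H.len d.1 - u) (H.len d'.1 - u')]
      have k1 := key s hs0.le hs1 hs2
      have k2 := key (s / 2) (by linarith) (by linarith) (by linarith)
      have hfst : d.1 = d'.1 := by
        rw [opt_inner d (by linarith) (by linarith), opt_inner d' (by linarith) (by linarith)] at k1
        exact (Point.inner.inj k1).1
      rcases eq_or_eq_rev_of_fst_eq hfst with h | h
      · exact h
      · rw [← rev_rev d', ← h, opt_rev] at k1 k2
        have e1 := opt_injOn (by linarith) (by linarith) k1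
        have e2 := opt_injOn (by linarith) (by linarith) k2
        linarith
    have hmaps : ∀ x, ∀ d ∈ dirs x, σ d ∈ dirs (φ x) := fun x d hd => (hx x d hd).1
    have hle : ∀ x, deg x ≤ deg (φ x) := fun x => Finset.card_le_card_of_injOn σ (hmaps x) (hinj x)
    let S : Finset H.Point := Finset.univ.image Point.vertex ∪
      Finset.univ.image fun v => φ.symm (.vertex v)
    have h1 := sum_deg_sub_two S fun v => by simp [S]
    have h2 := sum_deg_sub_two (S.map φ.toEmbedding) fun v => by
      refine Finset.mem_map.2 ⟨φ.symm (.vertex v), by simp [S], by simp⟩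
    rw [Finset.sum_map] at h2
    have h3 : ∀ x ∈ S, ((deg x : ℤ) - 2) = (deg (φ x) : ℤ) - 2 :=
      (Finset.sum_eq_sum_iff_of_le fun x _ => by
        have := hle x; omega).1 (by rw [h1, hg, ← h2]; rfl)
    have heq : ∀ x, deg x = deg (φ x) := by
      intro x
      by_cases hxS : x ∈ S
      · have := h3 x hxS; omega
      · rcases hx1 : x with v | ⟨e, t⟩
        · exact absurd (by simp [S, hx1]) hxS
        · rw [← hx1]
          rcases hx2 : φ x with v | ⟨e', t'⟩
          · have hxv : φ.symm (.vertex v) = x := by rw [← hx2, φ.symm_apply_apply]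
            exact absurd (by simp [S, ← hxv]) hxS
          · rw [hx1, deg_inner, deg_inner]
    intro x
    refine ⟨σ, ⟨hmaps x, hinj x, Finset.surjOn_of_injOn_of_card_le σ (hmaps x) (hinj x) (heq x).ge⟩,
      fun d hd => ?_⟩
    obtain ⟨-, δ, hδ, h⟩ := hx x d hd
    exact eventually_of_pos hδ fun s h0 h1 => h s h0.le h1

/-- An isomorphism of weighted graphs, which may reverse the orientations of edges, induces an
isometry. The edge `e` is mapped to the oriented edge `o e`. -/
noncomputable def MetricIso.ofGraph (α : H.V ≃ Γ.V) (o : H.E → Γ.OEdge)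
    (ho : Function.Bijective fun e => (o e).1) (hlen : ∀ e, Γ.len (o e).1 = H.len e)
    (hs : ∀ e, start (o e) = α (H.src e)) (ht : ∀ e, finish (o e) = α (H.tgt e)) : MetricIso H Γ :=
  MetricIso.ofEdges
    (Equiv.ofBijective (fun x => match x with
      | .vertex v => .vertex (α v)
      | .inner e t => opt (o e) t) (by
      constructor
      · rintro (v | ⟨e, t⟩) (v' | ⟨e', t'⟩) h
        · simpa using h
        · simp only at h
          rw [opt_inner _ t'.2.1 (by rw [hlen]; exact t'.2.2)] at h; cases h
        · simp only at h
          rw [opt_inner _ t.2.1 (by rw [hlen]; exact t.2.2)] at h; cases h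
        · simp only at h
          have h' := h
          rw [opt_inner _ t.2.1 (by rw [hlen]; exact t.2.2),
            opt_inner _ t'.2.1 (by rw [hlen]; exact t'.2.2)] at h
          have := ho.1 (Point.inner.inj h).1
          subst this
          have := opt_injOn t.2.1 (by rw [hlen]; exact t.2.2) h'
          rw [Subtype.ext this]
      · rintro (v | ⟨e, t⟩)
        · exact ⟨.vertex (α.symm v), by simp⟩
        · obtain ⟨e', rfl⟩ := ho.2 e
          have h1 := t.2.1
          have h2 := t.2.2
          have h3 := hlen e'
          rcases eq_or_eq_rev_of_fst_eq (d := ((o e').1, true)) (d' := o e') rfl with h | h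
          · refine ⟨.inner e' ⟨t, h1, h3 ▸ h2⟩, ?_⟩
            show opt (o e') t = _
            rw [inner_eq_opt, h]
          · refine ⟨.inner e' ⟨Γ.len (o e').1 - t, by simpa using h2, by linarith⟩, ?_⟩
            show opt (o e') (Γ.len (o e').1 - t) = _
            rw [inner_eq_opt, h, opt_rev]))
    (by
      rw [genus, genus, Fintype.card_congr α, Fintype.card_of_bijective ho])
    (fun e => by
      refine ⟨o e, 0, le_rfl, by rw [hlen, zero_add], fun s h0 h1 => ?_⟩
      rw [zero_add]
      rcases h0.eq_or_lt with rfl | h0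
      · rw [opt_zero, opt_zero, hs]; rfl
      rcases h1.eq_or_lt with rfl | h1
      · rw [opt_len ((e, true) : H.OEdge), ← hlen, opt_len, ht]; rfl
      · rw [opt_inner ((e, true) : H.OEdge) h0 h1]; rfl)

theorem connected_of_slopes (hne : Nonempty Γ.Point)
    (h : ∀ f : Γ.Point → ℝ, LocPL f → (∀ x, ∀ d ∈ dirs x, slope f x d ≤ 0) → ∀ x y, f x = f y) :
    Γ.Connected := by
  classical
  constructor
  · obtain ⟨v | ⟨e, t⟩⟩ := hne
    · exact ⟨v⟩
    · exact ⟨Γ.src e⟩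
  intro a b
  set r := Relation.EqvGen (fun x y => ∃ e, Γ.src e = x ∧ Γ.tgt e = y) with hr
  -- the characteristic function of the connected component of `a`
  let f : Γ.Point → ℝ := fun x => match x with
    | .vertex v => if r a v then 1 else 0
    | .inner e _ => if r a (Γ.src e) then 1 else 0
  have hiff : ∀ e, r a (Γ.src e) ↔ r a (Γ.tgt e) := fun e =>
    ⟨fun h => h.trans _ _ _ (.rel _ _ ⟨e, rfl, rfl⟩),
      fun h => h.trans _ _ _ ((Relation.EqvGen.rel _ _ ⟨e, rfl, rfl⟩).symm)⟩
  have hf1 : ∀ e s, f (opt (e, true) s) = if r a (Γ.src e) then 1 else 0 := by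
    intro e s
    rcases le_or_gt s 0 with h0 | h0
    · rw [opt_of_nonpos _ h0]; rfl
    rcases lt_or_ge s (Γ.len e) with h1 | h1
    · rw [opt_inner ((e, true) : Γ.OEdge) h0 h1]
    · rw [opt_of_len_le ((e, true) : Γ.OEdge) h1]
      show (if r a (Γ.tgt e) then (1 : ℝ) else 0) = _
      simp only [hiff]
  have hf2 : ∀ (d : Γ.OEdge) s t, f (opt d s) = f (opt d t) := by
    rintro ⟨e, b⟩ s t
    cases b
    · have e1 : ∀ s, opt (e, false) s = opt (e, true) (Γ.len e - s) := fun s => opt_rev (e, true) s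
      rw [e1, e1, hf1, hf1]
    · rw [hf1, hf1]
  have hsl : ∀ x, ∀ d ∈ dirs x, ∀ s, f (walk x d s) = f x := by
    intro x d hd s
    obtain ⟨u, h0, h1, rfl⟩ := exists_opt_of_mem_dirs hd
    rw [walk_opt d h0 h1]; exact hf2 _ _ _
  have hab := h f (fun x d hd => ⟨0, by simp [hsl x d hd]⟩)
    (fun x d hd => (slope_eq (m := 0) (by simp [hsl x d hd])).le) (.vertex a) (.vertex b)
  by_contra hn
  have h1 : r a a := .refl a
  simp [f, h1, hn] at hab

theorem Connected.of_iso (hΓ : Γ.Connected) (φ : MetricIso H Γ) : H.Connected := by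
  refine connected_of_slopes (hΓ.1.map fun v => φ.toEquiv.symm (.vertex v)) fun f hf hs x y => ?_
  have := eq_of_slopes_nonpos hΓ (hf.comp φ.symm) (fun x d hd => by
    obtain ⟨σ, hσ, h⟩ := φ.symm.exists_slope_eq x
    rw [h d hd f hf]
    exact hs _ _ (hσ.mapsTo hd)) (φ.toEquiv x) (φ.toEquiv y)
  have hx : ∀ x, φ.symm.toEquiv (φ.toEquiv x) = x := φ.toEquiv.symm_apply_apply
  rwa [hx, hx] at this

open Classical in
/-- The subdivision of `Γ` with an additional vertex `none` at the inner point `t` of the edge `e₀`,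
whose second half is the additional edge `none`. -/
noncomputable def split (Γ : WeightedGraph.{u, v}) (e₀ : Γ.E) (t : Set.Ioo (0 : ℝ) (Γ.len e₀)) :
    WeightedGraph.{u, v} where
  V := Option Γ.V
  E := Option Γ.E
  src := fun e => match e with
    | some e => some (Γ.src e)
    | none => none
  tgt := fun e => match e with
    | some e => if e = e₀ then none else some (Γ.tgt e)
    | none => some (Γ.tgt e₀)
  len := fun e => match e with
    | some e => if e = e₀ then t else Γ.len e
    | none => Γ.len e₀ - t
  len_pos := fun e => match e with
    | some e => by
      have h1 := t.2.1
      have h2 := Γ.len_pos e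
      dsimp only
      split_ifs <;> assumption
    | none => by
      have h1 := t.2.2
      dsimp only
      linarith

section Split

variable (e₀ : Γ.E) (t : Set.Ioo (0 : ℝ) (Γ.len e₀))

/-- The map from the subdivided graph to the original one. -/
noncomputable def splitFun : (Γ.split e₀ t).Point → Γ.Point
  | .vertex (some v) => .vertex v
  | .vertex none => .inner e₀ t
  | .inner (some e) s => Γ.edgePt e s
  | .inner none s => Γ.edgePt e₀ (t + s)

open Classical in
/-- The map from a graph to its subdivision. -/
noncomputable def splitInv : Γ.Point → (Γ.split e₀ t).Point
  | .vertex v => .vertex (some v)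
  | .inner e s => if e = e₀ then
      (if (s : ℝ) ≤ t then (Γ.split e₀ t).edgePt (some e₀) s
        else (Γ.split e₀ t).edgePt none (s - t))
      else (Γ.split e₀ t).edgePt (some e) s

theorem split_len_self : (Γ.split e₀ t).len (some e₀) = t := by simp [split]

theorem split_len_ne {e : Γ.E} (h : e ≠ e₀) : (Γ.split e₀ t).len (some e) = Γ.len e := by
  simp [split, h]

theorem split_len_none : (Γ.split e₀ t).len none = Γ.len e₀ - t := rfl

theorem split_tgt_self : (Γ.split e₀ t).tgt (some e₀) = none := by simp [split]

theorem split_tgt_ne {e : Γ.E} (h : e ≠ e₀) :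
    (Γ.split e₀ t).tgt (some e) = some (Γ.tgt e) := by
  simp [split, h]

theorem split_len_le (e : Γ.E) : (Γ.split e₀ t).len (some e) ≤ Γ.len e := by
  by_cases h : e = e₀
  · subst h; rw [split_len_self]; exact t.2.2.le
  · rw [split_len_ne _ _ h]

theorem splitFun_some (e : Γ.E) {s : ℝ} (h0 : 0 ≤ s) (h1 : s ≤ (Γ.split e₀ t).len (some e)) :
    splitFun e₀ t ((Γ.split e₀ t).edgePt (some e) s) = Γ.edgePt e s := by
  rcases h0.eq_or_lt with rfl | h0
  · exact (congrArg (splitFun e₀ t)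
      (edgePt_of_nonpos (Γ := Γ.split e₀ t) (some e) le_rfl)).trans (edgePt_of_nonpos e le_rfl).symm
  rcases h1.lt_or_eq with h1 | h1
  · rw [edgePt_of_mem _ ⟨h0, h1⟩]; rfl
  · rw [edgePt_of_len_le _ h1.ge]
    by_cases h : e = e₀
    · subst h
      rw [split_len_self] at h1
      rw [h1, edgePt_inner]
      simp [split, splitFun]
    · rw [split_len_ne _ _ h] at h1
      rw [edgePt_of_len_le _ h1.ge]
      simp [split, splitFun, h]

theorem splitFun_none {s : ℝ} (h0 : 0 ≤ s) (h1 : s ≤ Γ.len e₀ - t) :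
    splitFun e₀ t ((Γ.split e₀ t).edgePt none s) = Γ.edgePt e₀ (t + s) := by
  have ht := t.2.1
  have h1 : s ≤ (Γ.split e₀ t).len none := h1
  rcases h0.eq_or_lt with rfl | h0
  · rw [add_zero, edgePt_inner]
    exact congrArg (splitFun e₀ t) (edgePt_of_nonpos (Γ := Γ.split e₀ t) none le_rfl)
  rcases h1.lt_or_eq with h1 | h1
  · rw [edgePt_of_mem _ ⟨h0, h1⟩]; rfl
  · rw [edgePt_of_len_le _ h1.ge,
      edgePt_of_len_le _ (by rw [h1, split_len_none]; linarith)]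
    rfl

/-- The geometric representations of a graph and its subdivision agree. -/
noncomputable def splitIso : MetricIso (Γ.split e₀ t) Γ :=
  MetricIso.ofEdges
    { toFun := splitFun e₀ t
      invFun := splitInv e₀ t
      left_inv := by
        rintro ((_ | v) | ⟨_ | e, s⟩)
        · have h := split_len_self e₀ t
          simp only [splitFun, splitInv, if_true, le_refl]
          rw [edgePt_of_len_le _ h.le]
          simp [split]
        · rfl
        · have h1 := s.2.1
          have h2 : (s : ℝ) < Γ.len e₀ - t := s.2.2
          have h3 := t.2.1
          have e1 : Γ.edgePt e₀ (t + s) = .inner e₀ ⟨t + s, by linarith, by linarith⟩ :=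
            edgePt_of_mem e₀ ⟨by linarith, by linarith⟩
          simp only [splitFun]
          rw [e1]
          simp only [splitInv, if_true]
          rw [if_neg (by linarith), add_sub_cancel_left]
          exact edgePt_inner (Γ := Γ.split e₀ t) none s
        · have h1 := s.2.1
          have h2 := s.2.2
          have h3 := split_len_le e₀ t e
          have e1 : Γ.edgePt e s = .inner e ⟨s, h1, by linarith⟩ := edgePt_of_mem e ⟨h1, by linarith⟩
          simp only [splitFun]
          rw [e1]
          simp only [splitInv]
          by_cases h : e = e₀
          · subst h
            rw [if_pos rfl, if_pos (h2.le.trans (split_len_self _ t).le)]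
            exact edgePt_inner (Γ := Γ.split e t) (some e) s
          · rw [if_neg h]
            exact edgePt_inner (Γ := Γ.split e₀ t) (some e) s
      right_inv := by
        rintro (v | ⟨e, s⟩)
        · rfl
        · have h1 := s.2.1
          have h2 := s.2.2
          simp only [splitInv]
          by_cases h : e = e₀
          · subst h
            rw [if_pos rfl]
            split_ifs with hst
            · rw [splitFun_some _ _ _ h1.le (by rwa [split_len_self]), edgePt_inner]
            · rw [splitFun_none _ _ (by linarith) (by linarith), add_sub_cancel, edgePt_inner]
          · rw [if_neg h, splitFun_some _ _ _ h1.le (by rw [split_len_ne _ _ h]; exact h2.le),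
              edgePt_inner] }
    (by
      have h1 : Fintype.card (Γ.split e₀ t).E = Fintype.card Γ.E + 1 :=
        Fintype.card_option (α := Γ.E)
      have h2 : Fintype.card (Γ.split e₀ t).V = Fintype.card Γ.V + 1 :=
        Fintype.card_option (α := Γ.V)
      rw [genus, genus, h1, h2]; push_cast; ring)
    (by
      rintro (_ | e)
      · refine ⟨(e₀, true), t, t.2.1.le, by rw [split_len_none]; simp, fun s h0 h1 => ?_⟩
        rw [opt_true]
        exact (congrArg (splitFun e₀ t) (opt_true (Γ := Γ.split e₀ t) none s)).trans
          (splitFun_none e₀ t h0 h1)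
      · refine ⟨(e, true), 0, le_rfl, by simpa using split_len_le e₀ t e, fun s h0 h1 => ?_⟩
        rw [opt_true, zero_add]
        exact (congrArg (splitFun e₀ t) (opt_true (Γ := Γ.split e₀ t) (some e) s)).trans
          (splitFun_some e₀ t e h0 h1))

theorem splitIso_some (v : Γ.V) : (splitIso e₀ t).toEquiv (.vertex (some v)) = .vertex v := rfl

theorem splitIso_none : (splitIso e₀ t).toEquiv (.vertex none) = .inner e₀ t := rfl

end Split

open Classical in
/-- Every finite set of points consists of vertices of a suitable model. -/
theorem exists_model_with_vertices (Γ : WeightedGraph.{u, v}) (S : Finset Γ.Point) :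
    ∃ (H : WeightedGraph.{u, v}) (φ : MetricIso H Γ), ∀ x ∈ S, ∃ v, φ.toEquiv (.vertex v) = x := by
  induction S using Finset.induction_on with
  | empty =>
    exact ⟨Γ, MetricIso.ofGraph (Equiv.refl _) (fun e => (e, true)) Function.bijective_id
      (fun _ => rfl) (fun _ => rfl) (fun _ => rfl), by simp⟩
  | insert y S _ ih =>
    obtain ⟨H, φ, hφ⟩ := ih
    rcases hy : φ.toEquiv.symm y with v | ⟨e, t⟩
    · refine ⟨H, φ, fun x hx => ?_⟩
      rcases Finset.mem_insert.1 hx with rfl | hx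
      · exact ⟨v, by rw [← hy, Equiv.apply_symm_apply]⟩
      · exact hφ x hx
    · refine ⟨H.split e t, (splitIso e t).trans φ, fun x hx => ?_⟩
      rcases Finset.mem_insert.1 hx with rfl | hx
      · refine ⟨none, ?_⟩
        show φ.toEquiv ((splitIso e t).toEquiv (.vertex none)) = x
        rw [splitIso_none, ← hy, Equiv.apply_symm_apply]
      · obtain ⟨v, hv⟩ := hφ x hx
        exact ⟨some v, hv⟩

end Models

/-! ### Firing a set of vertices -/

section Fire

variable {Γ : WeightedGraph.{u, v}}

open Classical in
/-- The function with value `ε` on the set of vertices `A` and on the edges inside `A`, which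
decreases to `0` along the edges leaving `A`, with the least integral steepness `⌈ε / len e⌉`
for which the value at the other end is `0`. -/
noncomputable def fire (A : Set Γ.V) (ε : ℝ) : Γ.Point → ℝ
  | .vertex v => if v ∈ A then ε else 0
  | .inner e t =>
    if Γ.src e ∈ A then
      if Γ.tgt e ∈ A then ε else max 0 (ε - ⌈ε / Γ.len e⌉₊ * t)
    else if Γ.tgt e ∈ A then max 0 (ε - ⌈ε / Γ.len e⌉₊ * (Γ.len e - t)) else 0

variable {A : Set Γ.V} {ε : ℝ}

theorem le_ceil_mul_len (ε : ℝ) (e : Γ.E) : ε ≤ ⌈ε / Γ.len e⌉₊ * Γ.len e := by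
  rw [← div_le_iff₀ (Γ.len_pos e)]; exact Nat.le_ceil _

theorem fire_vertex_of_mem {v : Γ.V} (h : v ∈ A) : fire A ε (.vertex v) = ε := if_pos h

theorem fire_vertex_of_notMem {v : Γ.V} (h : v ∉ A) : fire A ε (.vertex v) = 0 := if_neg h

theorem fire_opt_of_mem_mem (d : Γ.OEdge) (h1 : start d ∈ A) (h2 : finish d ∈ A) (s : ℝ) :
    fire A ε (opt d s) = ε := by
  rcases le_or_gt s 0 with h0 | h0
  · rw [opt_of_nonpos _ h0, fire_vertex_of_mem h1]
  rcases lt_or_ge s (Γ.len d.1) with h3 | h3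
  · rw [opt_inner _ h0 h3]
    rcases d with ⟨e, b⟩
    cases b <;> simp_all [fire, start, finish, rev]
  · rw [opt_of_len_le _ h3, fire_vertex_of_mem h2]

theorem fire_opt_of_notMem_notMem (d : Γ.OEdge) (h1 : start d ∉ A) (h2 : finish d ∉ A) (s : ℝ) :
    fire A ε (opt d s) = 0 := by
  rcases le_or_gt s 0 with h0 | h0
  · rw [opt_of_nonpos _ h0, fire_vertex_of_notMem h1]
  rcases lt_or_ge s (Γ.len d.1) with h3 | h3
  · rw [opt_inner _ h0 h3]
    rcases d with ⟨e, b⟩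
    cases b <;> simp_all [fire, start, finish, rev]
  · rw [opt_of_len_le _ h3, fire_vertex_of_notMem h2]

theorem fire_opt_of_mem_notMem (hε : 0 < ε) (d : Γ.OEdge) (h1 : start d ∈ A) (h2 : finish d ∉ A)
    {s : ℝ} (hs0 : 0 ≤ s) (hs1 : s ≤ Γ.len d.1) :
    fire A ε (opt d s) = max 0 (ε - ⌈ε / Γ.len d.1⌉₊ * s) := by
  rcases hs0.eq_or_lt with rfl | h0
  · rw [opt_zero, fire_vertex_of_mem h1, mul_zero, sub_zero, max_eq_right hε.le]
  rcases hs1.lt_or_eq with h3 | rfl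
  · rw [opt_inner _ h0 h3]
    rcases d with ⟨e, b⟩
    cases b <;> simp_all [fire, start, finish, rev]
  · rw [opt_len, fire_vertex_of_notMem h2, max_eq_left]
    linarith [le_ceil_mul_len ε d.1]

theorem fire_opt_of_notMem_mem (hε : 0 < ε) (d : Γ.OEdge) (h1 : start d ∉ A) (h2 : finish d ∈ A)
    {s : ℝ} (hs0 : 0 ≤ s) (hs1 : s ≤ Γ.len d.1) :
    fire A ε (opt d s) = max 0 (ε - ⌈ε / Γ.len d.1⌉₊ * (Γ.len d.1 - s)) := by
  have := fire_opt_of_mem_notMem hε (rev d) (s := Γ.len d.1 - s) (by rwa [start_rev])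
    (by rwa [finish_rev]) (by linarith) (by simpa using hs0)
  rw [opt_rev, sub_sub_cancel] at this
  exact this

theorem fire_nonneg (hε : 0 < ε) (x : Γ.Point) : 0 ≤ fire A ε x := by
  rcases x with v | ⟨e, t⟩ <;> simp only [fire] <;> split_ifs <;> simp [hε.le]

theorem fire_slope_of_mem_notMem (hε : 0 < ε) (d : Γ.OEdge) (h1 : start d ∈ A) (h2 : finish d ∉ A)
    {u : ℝ} (hu0 : 0 ≤ u) (hu1 : u < Γ.len d.1) :
    RSlope (fun s => fire A ε (opt d s)) u
      (if 0 < ε - ⌈ε / Γ.len d.1⌉₊ * u then -(⌈ε / Γ.len d.1⌉₊ : ℝ) else 0) := by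
  set k : ℝ := (⌈ε / Γ.len d.1⌉₊ : ℝ) with hk
  have hk0 : 0 ≤ k := Nat.cast_nonneg _
  split_ifs with h
  · have h3 : ∀ᶠ s in 𝓝[>] (0 : ℝ), 0 < ε - k * (u + s) :=
      eventually_nhdsWithin_of_eventually_nhds
        (ContinuousAt.eventually_lt (by fun_prop) (by fun_prop) (by simpa using h))
    filter_upwards [h3, Ioo_mem_nhdsGT (show 0 < Γ.len d.1 - u by linarith)] with s hs1 hs2
    rw [fire_opt_of_mem_notMem hε d h1 h2 (by linarith [hs2.1]) (by linarith [hs2.2]),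
      fire_opt_of_mem_notMem hε d h1 h2 hu0 hu1.le, max_eq_right hs1.le, max_eq_right h.le]
    ring
  · filter_upwards [Ioo_mem_nhdsGT (show 0 < Γ.len d.1 - u by linarith)] with s hs2
    have : 0 ≤ k * s := mul_nonneg hk0 hs2.1.le
    rw [fire_opt_of_mem_notMem hε d h1 h2 (by linarith [hs2.1]) (by linarith [hs2.2]),
      fire_opt_of_mem_notMem hε d h1 h2 hu0 hu1.le, max_eq_left (by linarith),
      max_eq_left (by linarith)]
    ring

theorem fire_slope_of_notMem_mem (hε : 0 < ε) (d : Γ.OEdge) (h1 : start d ∉ A) (h2 : finish d ∈ A)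
    {u : ℝ} (hu0 : 0 ≤ u) (hu1 : u < Γ.len d.1) :
    RSlope (fun s => fire A ε (opt d s)) u
      (if 0 ≤ ε - ⌈ε / Γ.len d.1⌉₊ * (Γ.len d.1 - u) then (⌈ε / Γ.len d.1⌉₊ : ℝ) else 0) := by
  set k : ℝ := (⌈ε / Γ.len d.1⌉₊ : ℝ) with hk
  have hk0 : 0 ≤ k := Nat.cast_nonneg _
  split_ifs with h
  · filter_upwards [Ioo_mem_nhdsGT (show 0 < Γ.len d.1 - u by linarith)] with s hs2
    have : 0 ≤ k * s := mul_nonneg hk0 hs2.1.le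
    rw [fire_opt_of_notMem_mem hε d h1 h2 (by linarith [hs2.1]) (by linarith [hs2.2]),
      fire_opt_of_notMem_mem hε d h1 h2 hu0 hu1.le, max_eq_right (by linarith), max_eq_right h]
    ring
  · have h3 : ∀ᶠ s in 𝓝[>] (0 : ℝ), ε - k * (Γ.len d.1 - (u + s)) < 0 :=
      eventually_nhdsWithin_of_eventually_nhds
        (ContinuousAt.eventually_lt (by fun_prop) (by fun_prop) (by simpa using h))
    filter_upwards [h3, Ioo_mem_nhdsGT (show 0 < Γ.len d.1 - u by linarith)] with s hs1 hs2
    rw [fire_opt_of_notMem_mem hε d h1 h2 (by linarith [hs2.1]) (by linarith [hs2.2]),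
      fire_opt_of_notMem_mem hε d h1 h2 hu0 hu1.le, max_eq_left hs1.le, max_eq_left (by linarith)]
    ring

theorem locPL_fire (hε : 0 < ε) : LocPL (fire A ε) := by
  intro x d hd
  obtain ⟨u, h0, h1, rfl⟩ := exists_opt_of_mem_dirs hd
  simp only [walk_opt d h0 h1]
  by_cases ha : start d ∈ A <;> by_cases hb : finish d ∈ A
  · exact ⟨0, by simp [fire_opt_of_mem_mem d ha hb]⟩
  · have := fire_slope_of_mem_notMem hε d ha hb h0 h1
    exact ⟨if 0 < ε - ⌈ε / Γ.len d.1⌉₊ * u then -(⌈ε / Γ.len d.1⌉₊ : ℤ) else 0, by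
      push_cast; exact this⟩
  · have := fire_slope_of_notMem_mem hε d ha hb h0 h1
    exact ⟨if 0 ≤ ε - ⌈ε / Γ.len d.1⌉₊ * (Γ.len d.1 - u) then (⌈ε / Γ.len d.1⌉₊ : ℤ) else 0, by
      push_cast; exact this⟩
  · exact ⟨0, by simp [fire_opt_of_notMem_notMem d ha hb]⟩

/-- The order is nonnegative where the function is midpoint convex. -/
theorem ord_opt_nonneg {f : Γ.Point → ℝ} (hf : LocPL f) (d : Γ.OEdge) {u : ℝ} (h0 : 0 < u)
    (h1 : u < Γ.len d.1)
    (h : ∀ s, 0 < s → s < u → s < Γ.len d.1 - u →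
      2 * f (opt d u) ≤ f (opt d (u + s)) + f (opt d (u - s))) : 0 ≤ ord f (opt d u) := by
  rw [ord_opt f d h0 h1]
  obtain ⟨s, ⟨⟨h2, h3⟩, h4⟩, h5⟩ := ((((hf.rslope d h0.le h1).and (hf.lslope d h0 h1.le)).and
    (Ioo_mem_nhdsGT h0)).and (Ioo_mem_nhdsGT (show 0 < Γ.len d.1 - u by linarith))).exists
  have h6 := h s h4.1 h4.2 h5.2
  simp only at h2 h3
  rw [h2, h3] at h6
  have h7 : 0 ≤ ((slope f (opt d u) d : ℝ) + slope f (opt d u) (rev d)) * s := by linarith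
  exact_mod_cast nonneg_of_mul_nonneg_left h7 h4.1

theorem ord_fire_inner (hε : 0 < ε) (e : Γ.E) (t : Set.Ioo (0 : ℝ) (Γ.len e)) :
    0 ≤ ord (fire A ε) (.inner e t) := by
  rw [inner_eq_opt]
  refine ord_opt_nonneg (locPL_fire hε) _ t.2.1 t.2.2 fun s h0 h1 h2 => ?_
  have h2 : s < Γ.len e - t := h2
  have ht := t.2.1
  set d : Γ.OEdge := (e, true) with hd
  have hde : d.1 = e := rfl
  by_cases ha : start d ∈ A <;> by_cases hb : finish d ∈ A
  · simp only [fire_opt_of_mem_mem d ha hb]; linarith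
  · rw [fire_opt_of_mem_notMem hε d ha hb ht.le (by linarith),
      fire_opt_of_mem_notMem hε d ha hb (by linarith) (by linarith),
      fire_opt_of_mem_notMem hε d ha hb (by linarith) (by linarith), mul_add, mul_sub]
    set k : ℝ := (⌈ε / Γ.len d.1⌉₊ : ℝ)
    rcases max_cases 0 (ε - k * t) with h | h
    · rw [h.1]
      linarith [le_max_left 0 (ε - (k * t + k * s)), le_max_left 0 (ε - (k * t - k * s))]
    · rw [h.1]
      linarith [le_max_right 0 (ε - (k * t + k * s)), le_max_right 0 (ε - (k * t - k * s))]
  · rw [fire_opt_of_notMem_mem hε d ha hb ht.le (by linarith),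
      fire_opt_of_notMem_mem hε d ha hb (by linarith) (by linarith),
      fire_opt_of_notMem_mem hε d ha hb (by linarith) (by linarith)]
    set k : ℝ := (⌈ε / Γ.len d.1⌉₊ : ℝ)
    rcases max_cases 0 (ε - k * (Γ.len d.1 - t)) with h | h
    · rw [h.1]
      linarith [le_max_left 0 (ε - k * (Γ.len d.1 - (t + s))),
        le_max_left 0 (ε - k * (Γ.len d.1 - (t - s)))]
    · rw [h.1]
      linarith [le_max_right 0 (ε - k * (Γ.len d.1 - (t + s))),
        le_max_right 0 (ε - k * (Γ.len d.1 - (t - s)))]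
  · simp only [fire_opt_of_notMem_notMem d ha hb]; linarith

theorem fire_slope_nonneg (hε : 0 < ε) {v : Γ.V} (hv : v ∉ A) {d : Γ.OEdge}
    (hd : d ∈ dirs (.vertex v)) : 0 ≤ slope (fire A ε) (.vertex v) d := by
  have h := slope_le_slope (LocPL.const 0) (locPL_fire hε) hd (fire_vertex_of_notMem hv).symm
    (Eventually.of_forall fun s => fire_nonneg hε _)
  rwa [slope_eq (m := 0) (by simp)] at h

theorem ord_fire_of_notMem (hε : 0 < ε) {v : Γ.V} (hv : v ∉ A) :
    0 ≤ ord (fire A ε) (.vertex v) :=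
  Finset.sum_nonneg fun _ hd => fire_slope_nonneg hε hv hd

open Classical in
/-- Firing `A` by a distance at most the length of every edge moves one chip along every edge
leaving `A`. -/
theorem ord_fire_of_mem (hε : 0 < ε) (hle : ∀ e, ε ≤ Γ.len e) {v : Γ.V} (hv : v ∈ A) :
    ord (fire A ε) (.vertex v) =
      -((Finset.univ.filter fun d : Γ.OEdge => start d = v ∧ finish d ∉ A).card : ℤ) := by
  have hs : ∀ d ∈ dirs (.vertex v : Γ.Point), slope (fire A ε) (.vertex v) d =
      if finish d ∈ A then 0 else -1 := by
    intro d hd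
    rw [mem_dirs_vertex] at hd
    subst hd
    rw [← opt_zero]
    refine slope_opt_eq le_rfl (Γ.len_pos _) ?_
    split_ifs with h
    · refine Eventually.of_forall fun s => ?_
      simp only [fire_opt_of_mem_mem d hv h]; simp
    · have h1 := fire_slope_of_mem_notMem hε d hv h le_rfl (Γ.len_pos _)
      rw [mul_zero, sub_zero, if_pos hε] at h1
      have h2 : ⌈ε / Γ.len d.1⌉₊ = 1 := by
        rw [Nat.ceil_eq_iff one_ne_zero]
        have := Γ.len_pos d.1
        exact ⟨by simpa using div_pos hε this, by simpa using (div_le_one this).2 (hle d.1)⟩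
      rw [h2] at h1
      simpa using h1
  rw [ord, Finset.sum_congr rfl hs, Finset.sum_ite, Finset.sum_const_zero, zero_add,
    Finset.sum_const, nsmul_eq_mul, mul_neg, mul_one]
  congr 3
  ext d
  simp [dirs]

/-! ### Adding chips at a point makes a divisor effective -/

/-- `R(D)` is not empty. -/
def Eff (D : Γ.Divisor) : Prop := ∃ f : Γ.Point → ℝ, LocPL f ∧ ∀ x, 0 ≤ D x + ord f x

theorem Eff.of_nonneg {D : Γ.Divisor} (h : ∀ x, 0 ≤ D x) : Eff D :=
  ⟨fun _ => 0, .const 0, fun x => by rw [ord_const, add_zero]; exact h x⟩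

theorem Eff.add {D D' : Γ.Divisor} (h : Eff D) (h' : Eff D') : Eff (D + D') := by
  obtain ⟨f, hf, h⟩ := h
  obtain ⟨g, hg, h'⟩ := h'
  refine ⟨_, hf.add hg, fun x => ?_⟩
  rw [ord_add hf hg, Finsupp.add_apply]
  linarith [h x, h' x]

theorem Eff.nsmul {D : Γ.Divisor} (h : Eff D) (n : ℕ) : Eff (n • D) := by
  induction n with
  | zero => exact Eff.of_nonneg fun x => by simp
  | succ n ih => rw [succ_nsmul]; exact ih.add h

/-- A chip at `x` can be obtained from sufficiently many chips at `y`. -/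
def Dominates (y x : Γ.Point) : Prop := ∃ n : ℕ, Eff (Finsupp.single y (n : ℤ) - Finsupp.single x 1)

theorem Dominates.refl (x : Γ.Point) : Dominates x x := ⟨1, Eff.of_nonneg fun y => by simp⟩

theorem Dominates.trans {x y z : Γ.Point} (h : Dominates z y) (h' : Dominates y x) :
    Dominates z x := by
  obtain ⟨m, hm⟩ := h
  obtain ⟨n, hn⟩ := h'
  refine ⟨n * m, ?_⟩
  have := (hm.nsmul n).add hn
  have h2 : n • (Finsupp.single z (m : ℤ) - Finsupp.single y 1) +
      (Finsupp.single y (n : ℤ) - Finsupp.single x 1) =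
      Finsupp.single z ((n * m : ℕ) : ℤ) - Finsupp.single x 1 := by
    rw [smul_sub, Finsupp.smul_single, Finsupp.smul_single]
    simp
  rwa [h2] at this

theorem dominates_of_edge (d : Γ.OEdge) : Dominates (.vertex (finish d) : Γ.Point) (.vertex (start d)) := by
  by_cases hne : start d = finish d
  · rw [hne]; exact .refl _
  have hL := Γ.len_pos d.1
  set f := fire {finish d} (Γ.len d.1) with hf
  have hfl : LocPL f := locPL_fire hL
  have hd : d ∈ dirs (.vertex (start d)) := mem_dirs_vertex.2 rfl
  have hs1 : slope f (.vertex (start d)) d = 1 := by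
    rw [← opt_zero]
    refine slope_opt_eq le_rfl hL ?_
    have h1 := fire_slope_of_notMem_mem (A := {finish d}) hL d (by simpa using hne) rfl le_rfl hL
    rw [div_self hL.ne', Nat.ceil_one] at h1
    simpa using h1
  have hord : 1 ≤ ord f (.vertex (start d)) := by
    rw [← hs1]
    exact Finset.single_le_sum (f := fun d' => slope f (.vertex (start d)) d')
      (fun d' hd' => fire_slope_nonneg hL (by simpa using hne) hd') hd
  refine ⟨(-ord f (.vertex (finish d))).toNat, f, hfl, fun x => ?_⟩
  have hn := Int.self_le_toNat (-ord f (.vertex (finish d)))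
  rw [Finsupp.sub_apply]
  rcases x with v | ⟨e, t⟩
  · by_cases h1 : v = finish d
    · subst h1
      rw [Finsupp.single_eq_same, Finsupp.single_eq_of_ne (by simpa using Ne.symm hne)]
      linarith
    · rw [Finsupp.single_eq_of_ne (by simpa using h1)]
      by_cases h2 : v = start d
      · subst h2
        rw [Finsupp.single_eq_same]; linarith
      · rw [Finsupp.single_eq_of_ne (by simpa using h2)]
        have : 0 ≤ ord f (.vertex v) := ord_fire_of_notMem hL (by simpa using h1)
        linarith
  · rw [Finsupp.single_eq_of_ne (by simp), Finsupp.single_eq_of_ne (by simp)]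
    have : 0 ≤ ord f (.inner e t) := ord_fire_inner hL e t
    linarith

theorem dominates (hΓ : Γ.Connected) (y x : Γ.Point) : Dominates y x := by
  classical
  obtain ⟨H, φ, hφ⟩ := exists_model_with_vertices Γ {x, y}
  obtain ⟨a, rfl⟩ := hφ x (by simp)
  obtain ⟨b, rfl⟩ := hφ y (by simp)
  have hH := hΓ.of_iso φ
  have hr := hH.rel_of_edges (r := fun a b : H.V => Dominates (.vertex b) (.vertex a : H.Point) ∧
    Dominates (.vertex a) (.vertex b : H.Point))
    ⟨fun _ => ⟨.refl _, .refl _⟩, fun h => h.symm,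
      fun h1 h2 => ⟨h2.1.trans h1.1, h1.2.trans h2.2⟩⟩
    (fun e => ⟨dominates_of_edge (e, true), dominates_of_edge (e, false)⟩)
  obtain ⟨n, f, hf, h⟩ := (hr a b).1
  refine ⟨n, _, hf.comp φ.symm, fun x => ?_⟩
  obtain ⟨x, rfl⟩ := φ.toEquiv.surjective x
  rw [ord_comp hf φ.symm]
  have hx : φ.symm.toEquiv (φ.toEquiv x) = x := φ.toEquiv.symm_apply_apply x
  rw [hx]
  have := h x
  simpa [Finsupp.single_apply] using this

theorem exists_eff_add (hΓ : Γ.Connected) (P : Γ.Point) (D : Γ.Divisor) :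
    ∃ n : ℕ, Eff (D + Finsupp.single P (n : ℤ)) := by
  induction D using Finsupp.induction_linear with
  | zero => exact ⟨0, Eff.of_nonneg fun x => by simp⟩
  | add D D' h h' =>
    obtain ⟨n, hn⟩ := h
    obtain ⟨m, hm⟩ := h'
    refine ⟨n + m, ?_⟩
    have := hn.add hm
    rw [add_add_add_comm, ← Finsupp.single_add] at this
    exact_mod_cast this
  | single x k =>
    rcases le_or_gt 0 k with hk | hk
    · refine ⟨0, Eff.of_nonneg fun y => ?_⟩
      simpa using (Finsupp.single_nonneg.2 hk : 0 ≤ Finsupp.single x k) y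
    · obtain ⟨n, hn⟩ := dominates hΓ P x
      refine ⟨k.natAbs * n, ?_⟩
      have := hn.nsmul k.natAbs
      have h2 : k.natAbs • (Finsupp.single P (n : ℤ) - Finsupp.single x 1) =
          Finsupp.single x k + Finsupp.single P ((k.natAbs * n : ℕ) : ℤ) := by
        rw [smul_sub, Finsupp.smul_single, Finsupp.smul_single, nsmul_eq_mul, nsmul_eq_mul,
          mul_one, sub_eq_neg_add, ← Finsupp.single_neg, Int.natCast_natAbs, abs_of_neg hk,
          neg_neg]
        push_cast [abs_of_neg hk]
        rfl
      rwa [h2] at this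

end Fire

/-! ### Existence of reduced divisors -/

section Reduced

variable {Γ : WeightedGraph.{u, v}}

/-- Reducedness in terms of functions: `E` is effective away from `P`, and every function that keeps
`E` effective away from `P` attains its maximum at `P`. The usual definition only tests functions
that fire a closed connected set by a small distance. -/
def IsFunRed (P : Γ.Point) (E : Γ.Divisor) : Prop :=
  (∀ x, x ≠ P → 0 ≤ E x) ∧
    ∀ h : Γ.Point → ℝ, LocPL h → (∀ x, x ≠ P → 0 ≤ E x + ord h x) → ∀ x, h x ≤ h P

/-- Near a point, the functions in `R(D)` are convex in every direction, with bounded integral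
slopes, on a segment that does not depend on the function. -/
theorem exists_subgradients (D : Γ.Divisor) : ∃ C : ℤ, 0 ≤ C ∧
    (∀ f : Γ.Point → ℝ, LocPL f → (∀ x, 0 ≤ D x + ord f x) →
      ∀ x, ∀ d ∈ dirs x, slope f x d ≤ C) ∧
    ∀ x : Γ.Point, ∀ d ∈ dirs x, ∃ δ > 0, ∀ f : Γ.Point → ℝ, LocPL f →
      (∀ x, 0 ≤ D x + ord f x) → ∀ s ∈ Set.Icc 0 δ, ∃ m : ℤ, m ∈ Finset.Icc (-C) C ∧
        (s = 0 → m = slope f x d) ∧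
        ∀ t ∈ Set.Icc 0 δ, f (walk x d s) + m * (t - s) ≤ f (walk x d t) := by
  set D' : Γ.Divisor := D.mapRange (fun a => max a 0) (by simp) with hD'
  have h0 : ∀ x, 0 ≤ D' x := fun x => by simp [hD']
  have h1 : ∀ x, D x ≤ D' x := fun x => by simp [hD']
  have hC : ∀ f : Γ.Point → ℝ, LocPL f → (∀ x, 0 ≤ D x + ord f x) →
      ∀ x, ∀ d ∈ dirs x, slope f x d ≤ D'.degree ∧ -D'.degree ≤ slope f x d := by
    intro f hf hR x d hd
    have hR' : ∀ x, 0 ≤ D' x + ord f x := fun x => by linarith [hR x, h1 x]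
    exact ⟨slope_le_degree h0 hf hR' hd, neg_degree_le_slope h0 hf hR' hd⟩
  refine ⟨D'.degree, degree_nonneg_of_nonneg h0, fun f hf hR x d hd => (hC f hf hR x d hd).1, ?_⟩
  intro x d hd
  obtain ⟨u, hu0, hu1, rfl⟩ := exists_opt_of_mem_dirs hd
  -- a punctured segment without points of `D`
  obtain ⟨δ, hδ, hδu, hδD⟩ : ∃ δ > 0, δ < Γ.len d.1 - u ∧
      ∀ s, 0 < s → s ≤ δ → D (opt d (u + s)) = 0 := by
    have hfin : {s : ℝ | 0 < s ∧ s < Γ.len d.1 - u ∧ D (opt d (u + s)) ≠ 0}.Finite := by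
      refine Set.Finite.of_finite_image (f := fun s => opt d (u + s))
        (D.support.finite_toSet.subset ?_) ?_
      · rintro _ ⟨s, hs, rfl⟩
        simpa using hs.2.2
      · intro s hs t ht hst
        have := opt_injOn (by linarith [hs.1]) (by linarith [hs.2.1]) hst
        linarith
    have hev : ∀ᶠ s in 𝓝[>] (0 : ℝ),
        s ∉ {s : ℝ | 0 < s ∧ s < Γ.len d.1 - u ∧ D (opt d (u + s)) ≠ 0} :=
      eventually_nhdsWithin_of_eventually_nhds
        (hfin.isClosed.isOpen_compl.mem_nhds (by simp))
    obtain ⟨δ, hδ, hδu, h⟩ := exists_pos_of_eventually hev (b := Γ.len d.1 - u) (by linarith)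
    refine ⟨δ, hδ, hδu, fun s h2 h3 => ?_⟩
    by_contra hne
    exact h s h2 h3 ⟨h2, by linarith, hne⟩
  refine ⟨δ, hδ, fun f hf hR s hs => ?_⟩
  have hsum : ∀ v, u < v → v ≤ u + δ →
      (0 : ℝ) ≤ (slope f (opt d v) d : ℝ) + slope f (opt d v) (rev d) := by
    intro v hv1 hv2
    have h2 := hR (opt d v)
    have h3 := hδD (v - u) (by linarith) (by linarith)
    rw [add_sub_cancel] at h3
    rw [h3, zero_add, ord_opt f d (by linarith) (by linarith)] at h2
    exact_mod_cast h2
  have hconv : LocConvexOn (fun s => f (opt d s)) u (u + δ) := by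
    refine ⟨(hf.continuousOn d).mono (Set.Icc_subset_Icc hu0 (by linarith)), fun v hv1 hv2 =>
      ⟨_, _, hf.rslope d (by linarith) (by linarith), hf.lslope d (by linarith) (by linarith),
        hsum v hv1 hv2.le⟩⟩
  have hus : u + s < Γ.len d.1 := by linarith [hs.2]
  refine ⟨slope f (opt d (u + s)) d, ?_, ?_, fun t ht => ?_⟩
  · have := hC f hf hR _ d (mem_dirs_opt d hus)
    exact Finset.mem_Icc.2 ⟨this.2, this.1⟩
  · rintro rfl; rw [add_zero]
  · rw [walk_opt d hu0 hu1, walk_opt d hu0 hu1]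
    have := hconv.subgradient (s := u + s) (l := slope f (opt d (u + s)) (rev d))
      ⟨by linarith [hs.1], by linarith [hs.2]⟩ (hf.rslope d (by linarith [hs.1]) hus)
      (fun h => hf.lslope d (by linarith) hus.le) (fun h => hsum _ h (by linarith [hs.2]))
      (t := u + t) ⟨by linarith [ht.1], by linarith [ht.2]⟩
    simpa using this

/-- The functions in `R(D)` that vanish at `P` are bounded at every point. -/
theorem exists_bound (hΓ : Γ.Connected) (D : Γ.Divisor) (P x : Γ.Point) :
    ∃ B : ℝ, ∀ f : Γ.Point → ℝ, LocPL f → (∀ x, 0 ≤ D x + ord f x) → f P = 0 → f x ≤ B := by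
  obtain ⟨C, hC0, hC, -⟩ := exists_subgradients D
  let r : Γ.Point → Γ.Point → Prop := fun x y =>
    ∃ B : ℝ, ∀ f : Γ.Point → ℝ, LocPL f → (∀ x, 0 ≤ D x + ord f x) → |f x - f y| ≤ B
  have hr : Equivalence r := by
    refine ⟨fun x => ⟨0, by simp⟩, fun ⟨B, h⟩ => ⟨B, fun f h1 h2 => ?_⟩,
      fun ⟨B, h⟩ ⟨B', h'⟩ => ⟨B + B', fun f h1 h2 => ?_⟩⟩
    · rw [abs_sub_comm]; exact h f h1 h2
    · exact (abs_sub_le _ _ _).trans (add_le_add (h f h1 h2) (h' f h1 h2))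
  have hedge : ∀ (d : Γ.OEdge) (u : ℝ), 0 ≤ u → u ≤ Γ.len d.1 →
      r (.vertex (start d)) (opt d u) := by
    intro d u h0 h1
    refine ⟨C * u, fun f hf hR => ?_⟩
    have e1 := hf.lipschitz (hC f hf hR) d le_rfl h0 h1
    have e2 := hf.lipschitz (hC f hf hR) (rev d) (s := Γ.len d.1 - u) (t := Γ.len d.1)
      (by linarith) (by linarith) (by simp)
    rw [opt_rev, opt_rev, sub_self, sub_sub_cancel, opt_zero] at e2
    rw [opt_zero, sub_zero] at e1
    rw [abs_le]; constructor <;> linarith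
  have hV : ∀ a b : Γ.V, r (.vertex a) (.vertex b) := by
    refine hΓ.rel_of_edges ⟨fun _ => hr.refl _, fun h => hr.symm h, fun h h' => hr.trans h h'⟩
      fun e => ?_
    have := hedge (e, true) (Γ.len e) (Γ.len_pos e).le le_rfl
    rwa [show opt ((e, true) : Γ.OEdge) (Γ.len e) = _ from opt_len ((e, true) : Γ.OEdge)] at this
  have hx : ∀ x, ∃ v, r (.vertex v) x := by
    intro x
    rcases x.exists_opt with ⟨v, rfl⟩ | ⟨d, u, h0, h1, rfl⟩
    · exact ⟨v, hr.refl _⟩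
    · exact ⟨_, hedge d u h0.le h1.le⟩
  obtain ⟨a, ha⟩ := hx x
  obtain ⟨b, hb⟩ := hx P
  obtain ⟨B, hB⟩ := hr.trans (hr.symm ha) (hr.trans (hV a b) hb)
  refine ⟨B, fun f hf hR hP => ?_⟩
  have := hB f hf hR
  rw [hP, sub_zero] at this
  exact (le_abs_self _).trans this

/-- If `R(D)` is not empty, the pointwise supremum of the functions in `R(D)` that vanish at `P`
belongs to `R(D)`. -/
theorem exists_greatest (hΓ : Γ.Connected) {D : Γ.Divisor} (hD : Eff D) (P : Γ.Point) :
    ∃ F : Γ.Point → ℝ, LocPL F ∧ (∀ x, 0 ≤ D x + ord F x) ∧ F P = 0 ∧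
      ∀ f : Γ.Point → ℝ, LocPL f → (∀ x, 0 ≤ D x + ord f x) → f P = 0 → ∀ x, f x ≤ F x := by
  obtain ⟨f₀, hf₀, hR₀, hP₀⟩ : ∃ f : Γ.Point → ℝ, LocPL f ∧ (∀ x, 0 ≤ D x + ord f x) ∧ f P = 0 := by
    obtain ⟨f, hf, hR⟩ := hD
    refine ⟨_, hf.sub (.const (f P)), fun x => ?_, sub_self _⟩
    rw [ord_sub hf (.const _), ord_const, sub_zero]; exact hR x
  let T : Γ.Point → Set ℝ := fun x =>
    {y | ∃ f : Γ.Point → ℝ, LocPL f ∧ (∀ x, 0 ≤ D x + ord f x) ∧ f P = 0 ∧ f x = y}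
  have hTne : ∀ x, (T x).Nonempty := fun x => ⟨_, f₀, hf₀, hR₀, hP₀, rfl⟩
  have hTbd : ∀ x, BddAbove (T x) := fun x => by
    obtain ⟨B, hB⟩ := exists_bound hΓ D P x
    refine ⟨B, ?_⟩
    rintro _ ⟨f, hf, hR, hP, rfl⟩
    exact hB f hf hR hP
  set F : Γ.Point → ℝ := fun x => sSup (T x) with hF
  have hle : ∀ f : Γ.Point → ℝ, LocPL f → (∀ x, 0 ≤ D x + ord f x) → f P = 0 → ∀ x, f x ≤ F x :=
    fun f hf hR hP x => le_csSup (hTbd x) ⟨f, hf, hR, hP, rfl⟩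
  obtain ⟨C, hC0, -, hsub⟩ := exists_subgradients D
  have hFl : LocPL F := by
    intro x d hd
    obtain ⟨δ, hδ, hw⟩ := hsub x d hd
    have key : ∀ s ∈ Set.Icc 0 δ, ∃ m : ℤ, -C ≤ m ∧
        ∀ t ∈ Set.Icc 0 δ, F (walk x d s) + m * (t - s) ≤ F (walk x d t) := by
      intro s hs
      -- if no integer in `[-C, C]` were a subgradient of the supremum, then none would be a
      -- subgradient of a function whose value at `s` is close to it
      suffices h : ∃ m ∈ Finset.Icc (-C) C,
          ∀ t ∈ Set.Icc 0 δ, F (walk x d s) + m * (t - s) ≤ F (walk x d t) by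
        obtain ⟨m, hm, h⟩ := h
        exact ⟨m, (Finset.mem_Icc.1 hm).1, h⟩
      by_contra! hcon
      choose! t ht hlt using hcon
      have hne : (Finset.Icc (-C) C).Nonempty := ⟨0, by simp [hC0]⟩
      have hM : (Finset.Icc (-C) C).sup' hne (fun m => F (walk x d (t m)) - m * (t m - s)) <
          F (walk x d s) :=
        (Finset.sup'_lt_iff _).2 fun m hm => by linarith [hlt m hm]
      obtain ⟨_, ⟨f, hf, hR, hP, rfl⟩, hfs⟩ := exists_lt_of_lt_csSup (hTne _) hM
      obtain ⟨m, hm, -, hms⟩ := hw f hf hR s hs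
      have h1 := hms (t m) (ht m hm)
      have h2 := hle f hf hR hP (walk x d (t m))
      have h3 := Finset.le_sup' (fun m : ℤ => F (walk x d (t m)) - m * (t m - s)) hm
      linarith
    obtain ⟨m, hm⟩ := exists_rslope_of_subgradients (φ := fun s => F (walk x d s)) hδ key
    refine ⟨m, Filter.Eventually.mono hm fun s hs => ?_⟩
    simpa [walk_zero hd] using hs
  refine ⟨F, hFl, fun x => ?_, ?_, hle⟩
  · by_contra! hneg
    have hev : ∀ᶠ s in 𝓝[>] (0 : ℝ), ∀ d ∈ dirs x,
        F (walk x d s) = F x + slope F x d * s ∧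
          ∀ f : Γ.Point → ℝ, LocPL f → (∀ x, 0 ≤ D x + ord f x) →
            f x + slope f x d * s ≤ f (walk x d s) := by
      rw [Filter.eventually_all_finset]
      intro d hd
      obtain ⟨δ, hδ, hw⟩ := hsub x d hd
      filter_upwards [hFl.slope_spec hd, Ioo_mem_nhdsGT hδ] with s h1 h2
      refine ⟨h1, fun f hf hR => ?_⟩
      obtain ⟨m, -, hm0, hm⟩ := hw f hf hR 0 ⟨le_rfl, hδ.le⟩
      have := hm s ⟨h2.1.le, h2.2.le⟩
      rwa [walk_zero hd, hm0 rfl, sub_zero] at this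
    obtain ⟨s, hs, hs0⟩ := (hev.and (self_mem_nhdsWithin : Set.Ioi (0 : ℝ) ∈ 𝓝[>] (0 : ℝ))).exists
    have hs0 : 0 < s := hs0
    -- each `f` is steeper than the supremum in some direction, hence smaller at `x` by `s`
    have hfx : F x ≤ F x - s := by
      refine csSup_le (hTne x) ?_
      rintro _ ⟨f, hf, hR, hP, rfl⟩
      have h1 : ∑ d ∈ dirs x, slope F x d < ∑ d ∈ dirs x, slope f x d := by
        have := hR x
        simp only [ord] at this hneg
        linarith
      obtain ⟨d, hd, h2⟩ := Finset.exists_lt_of_sum_lt h1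
      have h3 := (hs d hd).2 f hf hR
      have h4 := (hs d hd).1
      have h5 := hle f hf hR hP (walk x d s)
      have h6 : (slope F x d : ℝ) + 1 ≤ slope f x d := by exact_mod_cast h2
      nlinarith
    linarith
  · refine le_antisymm (csSup_le (hTne P) ?_) (hP₀ ▸ hle f₀ hf₀ hR₀ hP₀ P)
    rintro _ ⟨f, hf, hR, hP, rfl⟩
    exact hP.le

theorem exists_isFunRed (hΓ : Γ.Connected) (D : Γ.Divisor) (P : Γ.Point) :
    ∃ f : Γ.RationalFunction, IsFunRed P (D + f.div) := by
  obtain ⟨n, hn⟩ := exists_eff_add hΓ P D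
  obtain ⟨F, hF, hR, hP, hmax⟩ := exists_greatest hΓ hn P
  have hoff : ∀ x, x ≠ P → 0 ≤ (D + hF.toRF.div) x := fun x hx => by
    have := hR x
    rwa [Finsupp.add_apply, Finsupp.single_eq_of_ne hx, add_zero] at this
  refine ⟨hF.toRF, hoff, fun h hh hE x => ?_⟩
  -- only the part of `h` above `h P` is added, so that the order at `P` is not negative
  have hc : LocPL (fun _ : Γ.Point => (0 : ℝ)) := .const 0
  have hh' := hh.sub (.const (h P))
  have hg := hh'.max hc
  have hgP : max (h P - h P) 0 = 0 := by simp
  have hx := hmax _ (hF.add hg) (fun y => ?_) (by rw [hP, hgP, add_zero]) x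
  · have := le_max_left (h x - h P) 0
    linarith
  · rw [ord_add hF hg]
    by_cases hy : y = P
    · subst hy
      have h1 := ord_le_ord hc hg hgP.symm fun z => le_max_right _ _
      rw [ord_const] at h1
      linarith [hR y]
    · have h1 := le_ord_max hh' hc (x := y) (c := -(D y + ord F y)) (by
        rw [ord_sub hh (.const _), ord_const, sub_zero]
        have : 0 ≤ D y + ord F y + ord h y := hE y hy
        linarith) (by
        rw [ord_const]
        have : 0 ≤ D y + ord F y := hoff y hy
        linarith)
      rw [Finsupp.add_apply, Finsupp.single_eq_of_ne hy]
      linarith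

end Reduced

/-! ### The coefficient of a reduced divisor at its base point -/

section Dhar

variable {Γ : WeightedGraph.{u, v}} {H : WeightedGraph.{w, z}}

open Classical in
/-- Burning the vertices of `A` one after the other, each of them removes at least `a v + 1` of the
edges that touch the set of the remaining vertices. -/
theorem sum_le_of_burning {a : Γ.V → ℤ} {p : Γ.V}
    (h : ∀ A : Finset Γ.V, A.Nonempty → p ∉ A → ∃ v ∈ A,
      a v < (Finset.univ.filter fun d : Γ.OEdge => start d = v ∧ finish d ∉ A).card)
    (A : Finset Γ.V) (hp : p ∉ A) :
    ∑ v ∈ A, a v ≤ ((Finset.univ.filter fun e => Γ.src e ∈ A ∨ Γ.tgt e ∈ A).card : ℤ) - A.card := by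
  induction A using Finset.strongInduction with
  | H A ih =>
    rcases A.eq_empty_or_nonempty with rfl | hne
    · simp
    obtain ⟨v, hv, hlt⟩ := h A hne hp
    have h1 := ih (A.erase v) (Finset.erase_ssubset hv) (fun hm => hp (Finset.mem_of_mem_erase hm))
    have h2 : (Finset.univ.filter fun d : Γ.OEdge => start d = v ∧ finish d ∉ A).card +
        (Finset.univ.filter fun e => Γ.src e ∈ A.erase v ∨ Γ.tgt e ∈ A.erase v).card ≤
        (Finset.univ.filter fun e => Γ.src e ∈ A ∨ Γ.tgt e ∈ A).card := by
      rw [← Finset.card_image_of_injOn (f := fun d : Γ.OEdge => d.1), ← Finset.card_union_of_disjoint]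
      · refine Finset.card_le_card fun e he => ?_
        simp only [Finset.mem_union, Finset.mem_image, Finset.mem_filter, Finset.mem_univ,
          true_and, Finset.mem_erase] at he ⊢
        rcases he with ⟨⟨e', b⟩, ⟨hs, -⟩, rfl⟩ | he
        · cases b
          · exact Or.inr (by rw [show Γ.tgt e' = v from hs]; exact hv)
          · exact Or.inl (by rw [show Γ.src e' = v from hs]; exact hv)
        · exact he.imp (·.2) (·.2)
      · rw [Finset.disjoint_left]
        intro e he he'
        simp only [Finset.mem_image, Finset.mem_filter, Finset.mem_univ,
          true_and, Finset.mem_erase] at he he'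
        obtain ⟨⟨e', b⟩, ⟨hs, ht⟩, rfl⟩ := he
        cases b
        · rw [show Γ.tgt e' = v from hs] at he'
          have ht : Γ.src e' ∉ A := ht
          simp [ht] at he'
        · rw [show Γ.src e' = v from hs] at he'
          have ht : Γ.tgt e' ∉ A := ht
          simp [ht] at he'
      · intro d hd d' hd' hdd
        simp only [Finset.coe_filter, Finset.mem_univ, true_and, Set.mem_ofPred_eq] at hd hd'
        rcases eq_or_eq_rev_of_fst_eq hdd with h | h
        · exact h
        · subst h
          rw [finish_rev] at hd
          exact absurd (hd'.1 ▸ hv) hd.2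
    rw [← Finset.add_sum_erase _ _ hv]
    have h3 := Finset.card_erase_add_one hv
    zify at h2 h3
    linarith

open Classical in
theorem sum_erase_le_genus {a : Γ.V → ℤ} {p : Γ.V}
    (h : ∀ A : Finset Γ.V, A.Nonempty → p ∉ A → ∃ v ∈ A,
      a v < (Finset.univ.filter fun d : Γ.OEdge => start d = v ∧ finish d ∉ A).card) :
    ∑ v ∈ Finset.univ.erase p, a v ≤ Γ.genus := by
  have h1 := sum_le_of_burning h (Finset.univ.erase p) (by simp)
  have h2 : (Finset.univ.filter fun e => Γ.src e ∈ Finset.univ.erase p ∨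
      Γ.tgt e ∈ Finset.univ.erase p).card ≤ Fintype.card Γ.E := Finset.card_le_univ _
  have h3 := Finset.card_erase_add_one (Finset.mem_univ p)
  rw [Finset.card_univ] at h3
  rw [genus]
  zify at h2 h3
  linarith

open Classical in
theorem IsFunRed.exists_lt {p : Γ.V} {E : Γ.Divisor} (h : IsFunRed (.vertex p) E)
    (A : Finset Γ.V) (hA : A.Nonempty) (hp : p ∉ A) : ∃ v ∈ A,
      E (.vertex v) < (Finset.univ.filter fun d : Γ.OEdge => start d = v ∧ finish d ∉ A).card := by
  by_contra! hcon
  obtain ⟨ε, hε, hle⟩ : ∃ ε > 0, ∀ e, ε ≤ Γ.len e := by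
    rcases isEmpty_or_nonempty Γ.E with hE | hE
    · exact ⟨1, one_pos, fun e => hE.elim e⟩
    · obtain ⟨e₀, he₀⟩ := Finite.exists_min Γ.len
      exact ⟨_, Γ.len_pos e₀, he₀⟩
  obtain ⟨v, hv⟩ := hA
  have h1 := h.2 (fire (A : Set Γ.V) ε) (locPL_fire hε) (fun x hx => ?_) (.vertex v)
  · rw [fire_vertex_of_mem (by simpa using hv), fire_vertex_of_notMem (by simpa using hp)] at h1
    linarith
  · rcases x with w | ⟨e, t⟩
    · by_cases hw : w ∈ A
      · rw [ord_fire_of_mem hε hle (by simpa using hw)]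
        have := hcon w hw
        simp only [Finset.mem_coe]
        linarith
      · linarith [ord_fire_of_notMem (A := (A : Set Γ.V)) hε (v := w) (by simpa using hw), h.1 _ hx]
    · linarith [ord_fire_inner (A := (A : Set Γ.V)) hε e t, h.1 _ hx]

theorem degree_eq_sum_vertices {E : Γ.Divisor} (hE : ∀ e t, E (.inner e t) = 0) :
    E.degree = ∑ v, E (.vertex v) := by
  obtain ⟨S, hS, -, h⟩ := exists_degree_eq E
  rw [h, add_eq_left]
  refine Finset.sum_eq_zero fun e _ => Finset.sum_eq_zero fun t ht => ?_
  rw [opt_inner _ (hS e t ht).1 (hS e t ht).2, hE]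

theorem IsFunRed.comp {P : H.Point} {φ : MetricIso H Γ} {E : Γ.Divisor}
    (h : IsFunRed (φ.toEquiv P) E) : IsFunRed P (E.equivMapDomain φ.toEquiv.symm) := by
  have hx : ∀ x, φ.symm.toEquiv (φ.toEquiv x) = x := φ.toEquiv.symm_apply_apply
  refine ⟨fun x hx => ?_, fun f hf hE x => ?_⟩
  · rw [Finsupp.equivMapDomain_apply]
    exact h.1 _ (by simpa using hx)
  · have := h.2 _ (hf.comp φ.symm) (fun y hy => ?_) (φ.toEquiv x)
    · rwa [hx, hx] at this
    · obtain ⟨y, rfl⟩ := φ.toEquiv.surjective y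
      rw [ord_comp hf φ.symm, hx]
      have := hE y (by rintro rfl; exact hy rfl)
      rwa [Finsupp.equivMapDomain_apply, Equiv.symm_symm] at this

theorem degree_equivMapDomain (φ : MetricIso H Γ) (E : Γ.Divisor) :
    (E.equivMapDomain φ.toEquiv.symm).degree = E.degree := by
  rw [Finsupp.equivMapDomain_eq_mapDomain, Finsupp.degree_mapDomain]

theorem IsFunRed.degree_sub_genus_le {P : Γ.Point} {E : Γ.Divisor} (h : IsFunRed P E) :
    E.degree - Γ.genus ≤ E P := by
  classical
  obtain ⟨H, φ, hφ⟩ := exists_model_with_vertices Γ (insert P E.support)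
  obtain ⟨p, rfl⟩ := hφ P (by simp)
  have hred := h.comp
  set E' := E.equivMapDomain φ.toEquiv.symm with hE'
  have hE'x : ∀ x, E' x = E (φ.toEquiv x) := fun x => by simp [hE']
  have hinner : ∀ e t, E' (.inner e t) = 0 := by
    intro e t
    by_contra hne
    rw [hE'x] at hne
    obtain ⟨v, hv⟩ := hφ (φ.toEquiv (.inner e t)) (by simp [hne])
    simp at hv
  have h1 := sum_erase_le_genus (a := fun v => E' (.vertex v)) hred.exists_lt
  have h2 := degree_eq_sum_vertices hinner
  rw [degree_equivMapDomain] at h2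
  rw [← Finset.add_sum_erase _ _ (Finset.mem_univ p), hE'x] at h2
  rw [← φ.genus_eq]
  linarith

/-! ### Reduced divisors in terms of closed sets -/

theorem continuous_edgePt (e : Γ.E) : Continuous (Γ.edgePt e) :=
  continuous_iff_coinduced_le.2 (le_iSup
    (fun e => TopologicalSpace.coinduced (Γ.edgePt e) inferInstance) e)

theorem continuous_opt (d : Γ.OEdge) : Continuous (opt d) := by
  refine (continuous_edgePt d.1).comp ?_
  split_ifs <;> fun_prop

theorem LocPL.continuous {f : Γ.Point → ℝ} (hf : LocPL f) : Continuous f := by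
  refine continuous_iSup_dom.2 fun e => continuous_coinduced_dom.2 ?_
  have h1 := (hf.continuousOn (e, true)).comp_continuous (f := fun s => Max.max 0 (min s (Γ.len e)))
    (by fun_prop) (fun s => ⟨le_max_left _ _, max_le (Γ.len_pos e).le (min_le_right _ _)⟩)
  refine h1.congr fun s => ?_
  show f (opt (e, true) (Max.max 0 (min s (Γ.len e)))) = f (Γ.edgePt e s)
  rcases le_or_gt s 0 with h | h
  · rw [min_eq_left (h.trans (Γ.len_pos e).le), max_eq_left h, opt_zero,
      edgePt_of_nonpos e h]; rfl
  rcases le_or_gt (Γ.len e) s with h' | h'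
  · rw [min_eq_right h', max_eq_right (Γ.len_pos e).le, opt_true, edgePt_of_len_le e h',
      edgePt_of_len_le e le_rfl]
  · rw [min_eq_left h'.le, max_eq_right h.le, opt_true]

instance : CompactSpace Γ.Point := by
  constructor
  have h : (Set.univ : Set Γ.Point) = Set.range Point.vertex ∪
      ⋃ e : Γ.E, Γ.edgePt e '' Set.Icc 0 (Γ.len e) := by
    refine (Set.eq_univ_of_forall fun x => ?_).symm
    rcases x with v | ⟨e, t⟩
    · exact Or.inl ⟨v, rfl⟩
    · exact Or.inr (Set.mem_iUnion.2 ⟨e, t, ⟨t.2.1.le, t.2.2.le⟩, edgePt_inner e t⟩)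
  rw [h]
  exact (Set.finite_range _).isCompact.union
    (isCompact_iUnion fun e => isCompact_Icc.image (continuous_edgePt e))

/-- Where `h` is maximal, it decreases in every direction that leaves the connected component of
the set of maximal points. -/
theorem IsReduced.isFunRed {P : Γ.Point} {E : Γ.Divisor} (hE : IsReduced P E) : IsFunRed P E := by
  classical
  refine ⟨hE.1, fun h hh hR x => ?_⟩
  by_contra! hlt
  obtain ⟨x₀, -, hmax⟩ := isCompact_univ.exists_isMaxOn ⟨x, Set.mem_univ x⟩ hh.continuous.continuousOn
  have hmax : ∀ y, h y ≤ h x₀ := fun y => hmax (Set.mem_univ y)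
  set X : Set Γ.Point := h ⁻¹' {h x₀} with hX
  have hXc : IsClosed X := isClosed_singleton.preimage hh.continuous
  have hx₀ : x₀ ∈ X := rfl
  set C := connectedComponentIn X x₀ with hC
  have hCX : C ⊆ X := connectedComponentIn_subset _ _
  have hCconn : IsConnected C := isConnected_connectedComponentIn_iff.2 hx₀
  have hCc : IsClosed C := by
    refine isClosed_of_closure_subset ?_
    exact hCconn.isPreconnected.closure.subset_connectedComponentIn
      (subset_closure (mem_connectedComponentIn hx₀)) (closure_minimal hCX hXc)
  have hPC : P ∉ C := fun hP => by
    have : h P = h x₀ := hCX hP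
    linarith [hmax x]
  obtain ⟨y, hy, hylt⟩ := hE.2 C hCc hCconn hPC
  have hyC : y ∈ C := hCc.frontier_subset hy
  have hyX : h y = h x₀ := hCX hyC
  have hslope : ∀ d ∈ dirs y, slope h y d ≤
      if ∃ ε > (0 : ℝ), ∀ s ∈ Set.Ioc 0 ε, walk y d s ∉ C then -1 else 0 := by
    intro d hd
    have h0 : slope h y d ≤ 0 := by
      have := slope_le_slope hh (LocPL.const (h y)) hd rfl
        (Eventually.of_forall fun s => by rw [hyX]; exact hmax _)
      rwa [slope_eq (m := 0) (f := fun _ => h y) (by simp)] at this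
    split_ifs with hout
    · obtain ⟨ε, hε, hout⟩ := hout
      by_contra! hgt
      have hz : slope h y d = 0 := by omega
      obtain ⟨δ, hδ, hδε, hs⟩ := exists_pos_of_eventually (hh.slope_spec hd) hε
      refine hout δ ⟨hδ, hδε.le⟩ ?_
      obtain ⟨u, hu0, hu1, rfl⟩ := exists_opt_of_mem_dirs hd
      -- `h` is constant on this segment, which therefore lies in the component
      have hseg : IsPreconnected (opt d '' Set.Icc u (u + δ)) :=
        isPreconnected_Icc.image _ (continuous_opt d).continuousOn
      have hsegX : opt d '' Set.Icc u (u + δ) ⊆ X := by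
        rintro _ ⟨s, hs', rfl⟩
        rcases hs'.1.eq_or_lt with rfl | hlt'
        · exact hyX
        · have := hs (s - u) (by linarith) (by linarith [hs'.2])
          rw [walk_opt d hu0 hu1, hz, add_sub_cancel] at this
          show h (opt d s) = h x₀
          rw [this, hyX]; simp
      have hsub := hseg.subset_connectedComponentIn
        (Set.mem_image_of_mem _ (⟨le_rfl, by linarith⟩ : u ∈ Set.Icc u (u + δ))) hsegX
      rw [walk_opt d hu0 hu1, hC, connectedComponentIn_eq hyC]
      exact hsub (Set.mem_image_of_mem _ ⟨by linarith, le_rfl⟩)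
    · exact h0
  have hord : ord h y ≤ -(outDeg C y : ℤ) := by
    refine (Finset.sum_le_sum hslope).trans ?_
    rw [Finset.sum_ite, Finset.sum_const_zero, add_zero, Finset.sum_const, nsmul_eq_mul, mul_neg,
      mul_one, outDeg]
  have := hR y (by rintro rfl; exact hPC hyC)
  linarith

end Dhar

/-! ### Banana graphs from divisors that are reduced at two points -/

section Banana

variable {Γ : WeightedGraph.{u, v}}

/-- The graph obtained from `Γ` by removing the vertex `x`, where only the directions `d₁` and `d₂`
start, and joining the edges of `d₁` and `d₂`. The edge of `d₁` becomes the joint edge, which runs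
from the end of `d₁` to the end of `d₂`. -/
noncomputable def merge (x : Γ.V) (d₁ d₂ : Γ.OEdge) (hd : ∀ d, start d = x ↔ d = d₁ ∨ d = d₂)
    (hne : d₁.1 ≠ d₂.1) : WeightedGraph.{u, v} :=
  haveI := Classical.decEq Γ.V
  haveI := Classical.decEq Γ.E
  { V := {v : Γ.V // v ≠ x}
    E := {e : Γ.E // e ≠ d₂.1}
    src := fun e => if h : e.1 = d₁.1 then
        ⟨finish d₁, fun hx => by
          rcases (hd (rev d₁)).1 hx with h' | h'
          · exact rev_ne _ h'
          · exact hne (show (rev d₁).1 = d₂.1 by rw [h'])⟩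
      else ⟨Γ.src e, fun hx => by
        rcases (hd (e, true)).1 hx with h' | h'
        · exact h (congrArg Prod.fst h')
        · exact e.2 (congrArg Prod.fst h')⟩
    tgt := fun e => if h : e.1 = d₁.1 then
        ⟨finish d₂, fun hx => by
          rcases (hd (rev d₂)).1 hx with h' | h'
          · exact hne (show d₁.1 = (rev d₂).1 by rw [h'])
          · exact rev_ne _ h'⟩
      else ⟨Γ.tgt e, fun hx => by
        rcases (hd (e, false)).1 hx with h' | h'
        · exact h (congrArg Prod.fst h')
        · exact e.2 (congrArg Prod.fst h')⟩
    len := fun e => if e.1 = d₁.1 then Γ.len d₁.1 + Γ.len d₂.1 else Γ.len e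
    len_pos := fun e => by
      have h1 := Γ.len_pos d₁.1
      have h2 := Γ.len_pos d₂.1
      have h3 := Γ.len_pos e
      split_ifs
      · linarith
      · exact h3 }

open Classical in
/-- Removing a vertex of degree two does not change the geometric representation: the original graph
is a subdivision of the resulting one. -/
theorem exists_model_without_vertex (x : Γ.V) (d₁ d₂ : Γ.OEdge)
    (hd : ∀ d, start d = x ↔ d = d₁ ∨ d = d₂) (hne : d₁.1 ≠ d₂.1) :
    ∃ (M : WeightedGraph.{u, v}) (φ : MetricIso M Γ), Fintype.card M.V < Fintype.card Γ.V ∧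
      ∀ v, v ≠ x → ∃ v', φ.toEquiv (.vertex v') = .vertex v := by
  set M := merge x d₁ d₂ hd hne with hM
  let e₁ : M.E := (⟨d₁.1, hne⟩ : {e : Γ.E // e ≠ d₂.1})
  have hlen : M.len e₁ = Γ.len d₁.1 + Γ.len d₂.1 := if_pos rfl
  let t : Set.Ioo (0 : ℝ) (M.len e₁) := ⟨Γ.len d₁.1, Γ.len_pos _, by
    rw [hlen]; linarith [Γ.len_pos d₂.1]⟩
  let α : (M.split e₁ t).V ≃ Γ.V := Equiv.optionSubtypeNe x
  let o : (M.split e₁ t).E → Γ.OEdge := fun e => match e with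
    | none => d₂
    | some e => if e.1 = d₁.1 then rev d₁ else (e.1, true)
  have ho1 : ∀ e, (o e).1 = (Equiv.optionSubtypeNe d₂.1 : Option {e : Γ.E // e ≠ d₂.1} ≃ Γ.E) e := by
    rintro (_ | e)
    · rfl
    · show (if e.1 = d₁.1 then rev d₁ else (e.1, true)).1 = e.1
      split_ifs with h
      · rw [h, rev_fst]
      · rfl
  have hstart : ∀ d, d = d₁ ∨ d = d₂ → start d = x := fun d => (hd d).2
  let ψ : MetricIso (M.split e₁ t) Γ := MetricIso.ofGraph α o
    (by
      have : (fun e => (o e).1) =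
        (Equiv.optionSubtypeNe d₂.1 : Option {e : Γ.E // e ≠ d₂.1} ≃ Γ.E) := funext ho1
      rw [this]; exact Equiv.bijective _)
    (by
      rintro (_ | e)
      · show Γ.len d₂.1 = M.len e₁ - Γ.len d₁.1
        rw [hlen]; ring
      · by_cases h : e = e₁
        · subst h
          rw [split_len_self]
          show Γ.len (if (e₁ : {e : Γ.E // e ≠ d₂.1}).1 = d₁.1 then rev d₁ else _).1 = Γ.len d₁.1
          rw [if_pos rfl, rev_fst]
        · rw [split_len_ne _ _ h]
          have h' : e.1 ≠ d₁.1 := fun he => h (Subtype.ext he)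
          show Γ.len (if e.1 = d₁.1 then rev d₁ else (e.1, true)).1 =
            if e.1 = d₁.1 then _ else Γ.len e.1
          rw [if_neg h', if_neg h'])
    (by
      rintro (_ | e)
      · exact hstart d₂ (Or.inr rfl)
      · show start (if e.1 = d₁.1 then rev d₁ else (e.1, true)) = (M.src e).1
        by_cases h : e.1 = d₁.1
        · rw [if_pos h]
          show _ = (dite (e.1 = d₁.1) _ _ : {v : Γ.V // v ≠ x}).1
          rw [dif_pos h]; rfl
        · rw [if_neg h]
          show _ = (dite (e.1 = d₁.1) _ _ : {v : Γ.V // v ≠ x}).1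
          rw [dif_neg h]; rfl)
    (by
      rintro (_ | e)
      · show _ = (dite (d₁.1 = d₁.1) _ _ : {v : Γ.V // v ≠ x}).1
        rw [dif_pos rfl]
      · by_cases h : e = e₁
        · subst h
          rw [split_tgt_self]
          show finish (if (e₁ : {e : Γ.E // e ≠ d₂.1}).1 = d₁.1 then rev d₁ else _) = _
          rw [if_pos rfl, finish_rev]
          exact hstart d₁ (Or.inl rfl)
        · have h' : e.1 ≠ d₁.1 := fun he => h (Subtype.ext he)
          rw [split_tgt_ne _ _ h]
          show finish (if e.1 = d₁.1 then rev d₁ else (e.1, true)) = _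
          rw [if_neg h']
          show _ = (dite (e.1 = d₁.1) _ _ : {v : Γ.V // v ≠ x}).1
          rw [dif_neg h']; rfl)
  refine ⟨M, (splitIso e₁ t).symm.trans ψ, ?_, fun v hv =>
    ⟨(⟨v, hv⟩ : {v : Γ.V // v ≠ x}), ?_⟩⟩
  · rw [Fintype.card_congr (show M.V ≃ {v : Γ.V // v ≠ x} from Equiv.refl _)]
    exact Fintype.card_subtype_lt (x := x) (by simp)
  · let v' : M.V := (⟨v, hv⟩ : {v : Γ.V // v ≠ x})
    have h1 : (splitIso e₁ t).toEquiv.symm (.vertex v') = .vertex (some v') := by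
      rw [Equiv.symm_apply_eq]
      exact (splitIso_some e₁ t v').symm
    exact congrArg ψ.toEquiv h1

theorem Connected.exists_mem_dirs (hΓ : Γ.Connected) {v w : Γ.V} (h : w ≠ v) :
    ∃ d : Γ.OEdge, start d = v := by
  by_contra! hno
  have := hΓ.rel_of_edges (r := fun a b => a = v ↔ b = v)
    ⟨fun _ => Iff.rfl, fun h => h.symm, fun h h' => h.trans h'⟩
    (fun e => iff_of_false (hno (e, true)) (hno (e, false))) w v
  exact h (this.2 rfl)

open Classical in
theorem card_out_le_deg (v : Γ.V) : (Finset.univ.filter fun d : Γ.OEdge =>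
    start d = v ∧ finish d ∉ ({v} : Finset Γ.V)).card ≤ deg (.vertex v : Γ.Point) :=
  Finset.card_le_card fun _ hd => mem_dirs_vertex.2 (Finset.mem_filter.1 hd).2.1

open Classical in
/-- The degrees of `p` and `q` are at least `g + 1`, which leaves no room for further vertices of
degree at least three. -/
theorem deg_eq_two (hΓ : Γ.Connected) {p q x : Γ.V} (hpq : p ≠ q) (hxp : x ≠ p) (hxq : x ≠ q)
    (hdeg : ∀ x : Γ.Point, deg x ≠ 1) (hp : Γ.genus + 1 ≤ deg (.vertex p : Γ.Point))
    (hq : Γ.genus + 1 ≤ deg (.vertex q : Γ.Point)) : deg (.vertex x : Γ.Point) = 2 := by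
  have h2 : ∀ v : Γ.V, 2 ≤ deg (.vertex v : Γ.Point) := by
    intro v
    obtain ⟨w, hw⟩ : ∃ w, w ≠ v := by
      by_cases h : p = v
      · exact ⟨q, fun h' => hpq (h.trans h'.symm)⟩
      · exact ⟨p, h⟩
    obtain ⟨d, hd⟩ := hΓ.exists_mem_dirs hw
    have h0 : 0 < deg (.vertex v : Γ.Point) := Finset.card_pos.2 ⟨d, mem_dirs_vertex.2 hd⟩
    have := hdeg (.vertex v)
    omega
  have hsum := sum_deg_vertices (Γ := Γ)
  have hle : ∑ v ∈ {p, q, x}, ((deg (.vertex v : Γ.Point) : ℤ) - 2) ≤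
      ∑ v, ((deg (.vertex v : Γ.Point) : ℤ) - 2) :=
    Finset.sum_le_sum_of_subset_of_nonneg (Finset.subset_univ _) fun v _ _ => by
      have := h2 v; omega
  rw [Finset.sum_insert (by simp [hpq, hxp.symm]), Finset.sum_insert (by simp [hxq.symm]),
    Finset.sum_singleton, Finset.sum_sub_distrib, hsum] at hle
  simp only [Finset.sum_const, Finset.card_univ, nsmul_eq_mul] at hle
  rw [genus] at hp hq
  have := h2 x
  omega

/-- At a vertex of degree two in a connected graph with another vertex there is no loop. -/
theorem exists_dirs_of_deg_eq_two (hΓ : Γ.Connected) {x p : Γ.V} (hxp : p ≠ x)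
    (hx : deg (.vertex x : Γ.Point) = 2) :
    ∃ d₁ d₂ : Γ.OEdge, (∀ d, start d = x ↔ d = d₁ ∨ d = d₂) ∧ d₁.1 ≠ d₂.1 := by
  classical
  obtain ⟨d₁, d₂, hne, h⟩ := Finset.card_eq_two.1 hx
  have hd : ∀ d, start d = x ↔ d = d₁ ∨ d = d₂ := fun d => by
    rw [← mem_dirs_vertex, h]; simp
  refine ⟨d₁, d₂, hd, fun hfst => hxp ?_⟩
  have hrev : d₁ = rev d₂ := (eq_or_eq_rev_of_fst_eq hfst).resolve_left hne
  have hfinish : ∀ d, start d = x → finish d = x := fun d hs => by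
    rw [← start_rev, hd]
    rcases (hd d).1 hs with h | h
    · exact Or.inr (by rw [h, hrev, rev_rev])
    · exact Or.inl (by rw [h, hrev])
  have := hΓ.rel_of_edges (r := fun a b => a = x ↔ b = x)
    ⟨fun _ => Iff.rfl, fun h => h.symm, fun h h' => h.trans h'⟩
    (fun e => ⟨hfinish (e, true), hfinish (e, false)⟩) p x
  exact this.2 rfl

/-- Every weighted graph is isomorphic to one with vertices and edges in the lowest universe. -/
theorem exists_small_model (Γ : WeightedGraph.{u, v}) :
    ∃ (H : WeightedGraph.{0, 0}) (α : H.V ≃ Γ.V) (β : H.E ≃ Γ.E),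
      (∀ e, α (H.src e) = Γ.src (β e)) ∧ (∀ e, α (H.tgt e) = Γ.tgt (β e)) ∧
      Nonempty (MetricIso H Γ) := by
  let α := (Fintype.equivFin Γ.V).symm
  let β := (Fintype.equivFin Γ.E).symm
  refine ⟨{ V := Fin (Fintype.card Γ.V), E := Fin (Fintype.card Γ.E)
            src := fun e => α.symm (Γ.src (β e)), tgt := fun e => α.symm (Γ.tgt (β e))
            len := fun e => Γ.len (β e), len_pos := fun e => Γ.len_pos _ }, α, β,
    fun e => α.apply_symm_apply _, fun e => α.apply_symm_apply _,
    ⟨MetricIso.ofGraph α (fun e => (β e, true)) β.bijective (fun _ => rfl)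
      (fun e => (α.apply_symm_apply _).symm) (fun e => (α.apply_symm_apply _).symm)⟩⟩

open Classical in
/-- If the vertices are `p` and `q`, then firing `q` shows that all edges join `q` to `p`. -/
theorem isBanana_of_forall_eq {p q : Γ.V} (hpq : p ≠ q) (hV : ∀ x, x = p ∨ x = q)
    (hq : Γ.genus < (Finset.univ.filter fun d : Γ.OEdge =>
      start d = q ∧ finish d ∉ ({q} : Finset Γ.V)).card) : Γ.IsBanana Γ.genus p q := by
  have hcard : Fintype.card Γ.V = 2 := by
    rw [← Finset.card_univ, show (Finset.univ : Finset Γ.V) = {p, q} by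
      ext x; simpa using hV x, Finset.card_pair hpq]
  have hE : (Fintype.card Γ.E : ℤ) = Γ.genus + 1 := by rw [genus, hcard]; push_cast; ring
  have himg : (Finset.univ.filter fun d : Γ.OEdge =>
      start d = q ∧ finish d ∉ ({q} : Finset Γ.V)).image (fun d => d.1) = Finset.univ := by
    rw [← Finset.card_eq_iff_eq_univ]
    refine le_antisymm (Finset.card_le_univ _) ?_
    rw [Finset.card_image_of_injOn]
    · zify; linarith
    · intro d hd d' hd' hdd
      simp only [Finset.coe_filter, Finset.mem_univ, true_and, Set.mem_ofPred_eq,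
        Finset.mem_singleton] at hd hd'
      rcases eq_or_eq_rev_of_fst_eq hdd with h | h
      · exact h
      · rw [h, finish_rev] at hd
        exact absurd hd'.1 hd.2
  refine ⟨hpq, hV, hE, fun e => ?_⟩
  have he := Finset.mem_univ e
  rw [← himg] at he
  simp only [Finset.mem_image, Finset.mem_filter, Finset.mem_univ, true_and,
    Finset.mem_singleton] at he
  obtain ⟨⟨e', b⟩, ⟨hs, ht⟩, rfl⟩ := he
  have ht := (hV _).resolve_right ht
  cases b
  · exact Or.inl ⟨ht, hs⟩
  · exact Or.inr ⟨hs, ht⟩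

theorem IsBanana.of_equiv {H : WeightedGraph.{w, z}} {g : ℤ} {p q : Γ.V} (h : Γ.IsBanana g p q)
    (α : H.V ≃ Γ.V) (β : H.E ≃ Γ.E) (hs : ∀ e, α (H.src e) = Γ.src (β e))
    (ht : ∀ e, α (H.tgt e) = Γ.tgt (β e)) : H.IsBanana g (α.symm p) (α.symm q) := by
  obtain ⟨h1, h2, h3, h4⟩ := h
  refine ⟨by simpa using h1, fun x => ?_, by rw [← h3, Fintype.card_congr β], fun e => ?_⟩
  · simp only [Equiv.eq_symm_apply]; exact h2 (α x)
  · simp only [Equiv.eq_symm_apply, hs, ht]; exact h4 (β e)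

/-- If a divisor is reduced at two vertices, with coefficient at least the genus at both, then
all other vertices have degree two, and removing them one by one leaves a banana graph. -/
theorem exists_banana_of_vertices (n : ℕ) : ∀ (Γ : WeightedGraph.{u, v}) (E : Γ.Divisor) (p q : Γ.V),
    Fintype.card Γ.V = n → Γ.Connected → p ≠ q → (∀ x : Γ.Point, deg x ≠ 1) →
    IsFunRed (.vertex p) E → IsFunRed (.vertex q) E →
    Γ.genus ≤ E (.vertex p) → Γ.genus ≤ E (.vertex q) →
    ∃ (H : WeightedGraph.{0, 0}) (p q : H.V), H.IsBanana Γ.genus p q ∧ Nonempty (MetricIso H Γ) := by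
  classical
  induction n using Nat.strong_induction_on with
  | _ n ih =>
    intro Γ E p q hn hΓ hpq hdeg hEp hEq hp hq
    obtain ⟨v, hv, hq'⟩ := hEp.exists_lt {q} (by simp) (by simpa using hpq)
    obtain rfl := Finset.mem_singleton.1 hv
    obtain ⟨w, hw, hp'⟩ := hEq.exists_lt {p} (by simp) (by simpa using hpq.symm)
    obtain rfl := Finset.mem_singleton.1 hw
    by_cases hV : ∀ x, x = w ∨ x = v
    · have hB := isBanana_of_forall_eq hpq hV (hq.trans_lt hq')
      obtain ⟨H, α, β, hs, ht, hφ⟩ := exists_small_model Γ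
      exact ⟨H, _, _, hB.of_equiv α β hs ht, hφ⟩
    · push Not at hV
      obtain ⟨x, hxp, hxq⟩ := hV
      have h1 := card_out_le_deg w
      have h2 := card_out_le_deg v
      zify at h1 h2
      have hx := deg_eq_two hΓ hpq hxp hxq hdeg (by linarith) (by linarith)
      obtain ⟨d₁, d₂, hd, hne⟩ := exists_dirs_of_deg_eq_two hΓ hxp.symm hx
      obtain ⟨M, φ, hM, hφ⟩ := exists_model_without_vertex x d₁ d₂ hd hne
      obtain ⟨p', hp2⟩ := hφ w hxp.symm
      obtain ⟨q', hq2⟩ := hφ v hxq.symm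
      obtain ⟨H, a, b, hB, ⟨ψ⟩⟩ := ih (Fintype.card M.V) (hn ▸ hM) M
        (E.equivMapDomain φ.toEquiv.symm) p' q' rfl (hΓ.of_iso φ)
        (fun h => hpq (Point.vertex.inj (by rw [← hp2, ← hq2, h])))
        (fun y => by rw [← φ.deg_eq]; exact hdeg _)
        (IsFunRed.comp (by rw [hp2]; exact hEp)) (IsFunRed.comp (by rw [hq2]; exact hEq))
        (by rw [Finsupp.equivMapDomain_apply, Equiv.symm_symm, hp2, φ.genus_eq]; exact hp)
        (by rw [Finsupp.equivMapDomain_apply, Equiv.symm_symm, hq2, φ.genus_eq]; exact hq)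
      rw [φ.genus_eq] at hB
      exact ⟨H, a, b, hB, ⟨ψ.trans φ⟩⟩

theorem exists_banana (hΓ : Γ.Connected) {E : Γ.Divisor} {P Q : Γ.Point} (hPQ : P ≠ Q)
    (hdeg : ∀ x : Γ.Point, deg x ≠ 1) (hEP : IsFunRed P E) (hEQ : IsFunRed Q E)
    (hP : Γ.genus ≤ E P) (hQ : Γ.genus ≤ E Q) :
    ∃ (H : WeightedGraph.{0, 0}) (p q : H.V), H.IsBanana Γ.genus p q ∧ Nonempty (MetricIso H Γ) := by
  classical
  obtain ⟨M, φ, hφ⟩ := exists_model_with_vertices Γ {P, Q}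
  obtain ⟨p, rfl⟩ := hφ P (by simp)
  obtain ⟨q, rfl⟩ := hφ Q (by simp)
  obtain ⟨H, a, b, hB, ⟨ψ⟩⟩ := exists_banana_of_vertices _ M (E.equivMapDomain φ.toEquiv.symm) p q
    rfl (hΓ.of_iso φ) (fun h => hPQ (by rw [h])) (fun y => by rw [← φ.deg_eq]; exact hdeg _)
    hEP.comp hEQ.comp
    (by rw [Finsupp.equivMapDomain_apply, Equiv.symm_symm, φ.genus_eq]; exact hP)
    (by rw [Finsupp.equivMapDomain_apply, Equiv.symm_symm, φ.genus_eq]; exact hQ)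
  rw [φ.genus_eq] at hB
  exact ⟨H, a, b, hB, ⟨ψ.trans φ⟩⟩

end Banana

/-! ### Very ample divisors -/

section VeryAmple

variable {Γ : WeightedGraph.{u, v}}

theorem mem_R_iff {D : Γ.Divisor} {f : Γ.RationalFunction} : f ∈ R D ↔ ∀ x, 0 ≤ D x + ord f x :=
  Iff.rfl

theorem degree_add_div (D : Γ.Divisor) (f : Γ.RationalFunction) :
    (D + f.div).degree = D.degree := by
  rw [map_add, degree_div, add_zero]

theorem add_le_degree {E : Γ.Divisor} {P Q : Γ.Point} (hPQ : P ≠ Q) (hE : ∀ x, x ≠ P → 0 ≤ E x) :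
    E P + E Q ≤ E.degree := by
  have h := apply_le_degree (D := E - Finsupp.single P (E P)) (fun x => ?_) Q
  · rw [Finsupp.sub_apply, Finsupp.single_eq_of_ne hPQ.symm, map_sub, Finsupp.degree_single] at h
    linarith
  · rw [Finsupp.sub_apply]
    by_cases hx : x = P
    · subst hx; simp
    · rw [Finsupp.single_eq_of_ne hx, sub_zero]; exact hE x hx

theorem apply_le_degree_of_ne {E : Γ.Divisor} {P : Γ.Point} (hE : ∀ x, x ≠ P → 0 ≤ E x) :
    E P ≤ E.degree := by
  have h := degree_nonneg_of_nonneg (D := E - Finsupp.single P (E P)) (fun x => ?_)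
  · rw [map_sub, Finsupp.degree_single] at h
    linarith
  · rw [Finsupp.sub_apply]
    by_cases hx : x = P
    · subst hx; simp
    · rw [Finsupp.single_eq_of_ne hx, sub_zero]; exact hE x hx

theorem Connected.genus_nonneg (hΓ : Γ.Connected) : 0 ≤ Γ.genus := by
  obtain ⟨v⟩ := hΓ.1
  obtain ⟨f, hf⟩ := exists_isFunRed hΓ 0 (.vertex v)
  have h1 := hf.degree_sub_genus_le
  have h2 := apply_le_degree_of_ne hf.1
  linarith

/-- If `R(D)` does not separate two points, then the reduced divisors at these points agree: the
function relating them has its maximum at one of the points and its minimum at the other. -/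
theorem exists_isFunRed_isFunRed (hΓ : Γ.Connected) {D : Γ.Divisor} (hD : Γ.genus ≤ D.degree)
    {P Q : Γ.Point} (h : ∀ f ∈ R D, ∀ g ∈ R D, f P - g P = f Q - g Q) :
    ∃ E : Γ.Divisor, IsFunRed P E ∧ IsFunRed Q E ∧ E.degree = D.degree := by
  have hmem : ∀ (P : Γ.Point) (f : Γ.RationalFunction), IsFunRed P (D + f.div) → f ∈ R D := by
    intro P f hf x
    by_cases hx : x = P
    · subst hx
      have := hf.degree_sub_genus_le
      rw [degree_add_div] at this
      exact (sub_nonneg.2 hD).trans this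
    · exact hf.1 x hx
  obtain ⟨f, hf⟩ := exists_isFunRed hΓ D P
  obtain ⟨g, hg⟩ := exists_isFunRed hΓ D Q
  have hfR := hmem P f hf
  have hgR := hmem Q g hg
  have h1 : ∀ x, g x - f x ≤ g P - f P := hf.2 _ (g.locPL.sub f.locPL) fun x _ => by
    rw [ord_sub g.locPL f.locPL, Finsupp.add_apply, RationalFunction.div_apply]
    linarith [mem_R_iff.1 hgR x]
  have h2 : ∀ x, f x - g x ≤ f Q - g Q := hg.2 _ (f.locPL.sub g.locPL) fun x _ => by
    rw [ord_sub f.locPL g.locPL, Finsupp.add_apply, RationalFunction.div_apply]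
    linarith [mem_R_iff.1 hfR x]
  have h3 := h f hfR g hgR
  have h4 : (fun x => g x - f x) = fun _ => g P - f P :=
    funext fun x => le_antisymm (h1 x) (by linarith [h2 x])
  have h5 : D + f.div = D + g.div := by
    ext x
    have h6 := ord_sub g.locPL f.locPL x
    rw [h4, ord_const] at h6
    rw [Finsupp.add_apply, Finsupp.add_apply, RationalFunction.div_apply,
      RationalFunction.div_apply]
    linarith
  exact ⟨D + f.div, hf, h5 ▸ hg, degree_add_div D f⟩

theorem veryAmple_of_degree (hΓ : Γ.Connected) {D : Γ.Divisor} (hD : 2 * Γ.genus + 1 ≤ D.degree) :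
    VeryAmple D := by
  intro P Q hPQ
  by_contra! hcon
  have hg := hΓ.genus_nonneg
  obtain ⟨E, hP, hQ, hE⟩ := exists_isFunRed_isFunRed hΓ (by linarith) hcon
  have h1 := hP.degree_sub_genus_le
  have h2 := hQ.degree_sub_genus_le
  have h3 := add_le_degree hPQ hP.1
  linarith

theorem ample_iff (hΓ : Γ.Connected) [Nontrivial Γ.Point] (D : Γ.Divisor) :
    Ample D ↔ 0 < D.degree := by
  constructor
  · rintro ⟨m, hm, hD⟩
    by_contra! hdeg
    obtain ⟨P, Q, hPQ⟩ := exists_pair_ne Γ.Point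
    obtain ⟨f, hf, g, hg, hne⟩ := hD P Q hPQ
    -- effective divisors of degree at most zero vanish, so that `div f` is determined by `D`
    have key : ∀ f ∈ R (m • D), ∀ x, (m • D) x + ord f x = 0 := fun f hf x => by
      have h1 := apply_le_degree (D := m • D + f.div) hf x
      rw [degree_add_div, map_nsmul, nsmul_eq_mul] at h1
      have h2 : (m : ℤ) * D.degree ≤ 0 := mul_nonpos_of_nonneg_of_nonpos (by positivity) hdeg
      exact le_antisymm (h1.trans h2) (hf x)
    apply hne
    refine eq_of_ord_eq_zero hΓ (f.locPL.sub g.locPL) (fun x => ?_) P Q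
    rw [ord_sub f.locPL g.locPL]
    linarith [key f hf x, key g hg x]
  · intro hD
    have hg := hΓ.genus_nonneg
    refine ⟨(2 * Γ.genus + 1).toNat, by omega, veryAmple_of_degree hΓ ?_⟩
    rw [map_nsmul, nsmul_eq_mul, Int.toNat_of_nonneg (by linarith)]
    nlinarith

theorem IsBanana.symm {g : ℤ} {p q : Γ.V} (h : Γ.IsBanana g p q) : Γ.IsBanana g q p :=
  ⟨h.1.symm, fun x => (h.2.1 x).symm, h.2.2.1, fun e => (h.2.2.2 e).symm⟩

theorem IsBanana.finish_eq {g : ℤ} {p q : Γ.V} (h : Γ.IsBanana g p q) {d : Γ.OEdge}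
    (hd : start d = p) : finish d = q := by
  rcases d with ⟨e, b⟩
  cases b
  · have hd : Γ.tgt e = p := hd
    rcases h.2.2.2 e with h' | h'
    · exact absurd (hd.symm.trans h'.2) h.1
    · exact h'.1
  · have hd : Γ.src e = p := hd
    rcases h.2.2.2 e with h' | h'
    · exact h'.2
    · exact absurd (hd.symm.trans h'.1) h.1

theorem IsBanana.le_deg {g : ℤ} {p q : Γ.V} (h : Γ.IsBanana g p q) :
    g + 1 ≤ deg (.vertex p : Γ.Point) := by
  classical
  rw [← h.2.2.1, ← Finset.card_univ, deg]
  refine Int.ofNat_le.2 (Finset.card_le_card_of_injOn (fun e => (e, decide (Γ.src e = p))) ?_ ?_)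
  · intro e _
    refine mem_dirs_vertex.2 ?_
    by_cases hs : Γ.src e = p
    · simp [start, hs]
    · rcases h.2.2.2 e with h' | h'
      · exact absurd h'.1 hs
      · simp [start, hs, h'.2]
  · intro e _ e' _ he
    exact congrArg Prod.fst he

/-- A function that is convex along the edges of a banana graph and larger at `p` than at `q`
decreases along all `g + 1` edges at `p`. -/
theorem IsBanana.le_of_ord {g : ℤ} {p q : Γ.V} (h : Γ.IsBanana g p q) {f : Γ.Point → ℝ}
    (hf : LocPL f) (hin : ∀ e t, 0 ≤ ord f (.inner e t)) (hp : -g ≤ ord f (.vertex p)) :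
    f (.vertex p) ≤ f (.vertex q) := by
  by_contra! hlt
  have hs : ∀ d ∈ dirs (.vertex p : Γ.Point), slope f (.vertex p) d ≤ -1 := by
    intro d hd
    rw [mem_dirs_vertex] at hd
    have hL := Γ.len_pos d.1
    have hc : LocConvexOn (fun s => f (opt d s)) 0 (Γ.len d.1) := by
      refine ⟨hf.continuousOn d, fun u h0 h1 => ⟨_, _, hf.rslope d h0.le h1,
        hf.lslope d h0 h1.le, ?_⟩⟩
      have : 0 ≤ ord f (opt d u) := by rw [opt_inner d h0 h1]; exact hin _ _
      rw [ord_opt f d h0 h1] at this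
      exact_mod_cast this
    have h1 := hc.tangent_le (hf.rslope d le_rfl hL) (t := Γ.len d.1) ⟨hL.le, le_rfl⟩
    simp only [opt_zero, opt_len, hd, h.finish_eq hd, sub_zero] at h1
    by_contra! hgt
    have h2 : 0 ≤ slope f (.vertex p) d := by omega
    have h3 : (0 : ℝ) ≤ slope f (.vertex p) d := by exact_mod_cast h2
    nlinarith [mul_nonneg h3 hL.le]
  have h1 : ord f (.vertex p) ≤ -deg (.vertex p : Γ.Point) := by
    refine (Finset.sum_le_sum hs).trans ?_
    simp [deg]
  linarith [h.le_deg]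

theorem not_veryAmple_of_isBanana {H : WeightedGraph.{w, z}} {g : ℤ} {p q : H.V}
    (h : H.IsBanana g p q) (φ : MetricIso H Γ) :
    ¬ VeryAmple (Finsupp.single (φ.toEquiv (.vertex p)) g +
      Finsupp.single (φ.toEquiv (.vertex q)) g : Γ.Divisor) := by
  intro hV
  set D : Γ.Divisor := Finsupp.single (φ.toEquiv (.vertex p)) g +
    Finsupp.single (φ.toEquiv (.vertex q)) g with hD
  have hpq : (Point.vertex p : H.Point) ≠ .vertex q := by simpa using h.1
  have key : ∀ f ∈ R D, f (φ.toEquiv (.vertex p)) = f (φ.toEquiv (.vertex q)) := by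
    intro f hf
    have hR : ∀ x, 0 ≤ D (φ.toEquiv x) + ord (fun x => f (φ.toEquiv x)) x := fun x => by
      rw [ord_comp f.locPL φ]; exact hf _
    have hin : ∀ e t, 0 ≤ ord (fun x => f (φ.toEquiv x)) (.inner e t) := fun e t => by
      have := hR (.inner e t)
      rwa [hD, Finsupp.add_apply, Finsupp.single_eq_of_ne (by simp),
        Finsupp.single_eq_of_ne (by simp), add_zero, zero_add] at this
    have hp := hR (.vertex p)
    have hq := hR (.vertex q)
    rw [hD, Finsupp.add_apply, Finsupp.single_eq_same,
      Finsupp.single_eq_of_ne (by simpa using h.1)] at hp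
    rw [hD, Finsupp.add_apply, Finsupp.single_eq_same,
      Finsupp.single_eq_of_ne (by simpa using h.1.symm)] at hq
    exact le_antisymm (h.le_of_ord (f.locPL.comp φ) hin (by linarith))
      (h.symm.le_of_ord (f.locPL.comp φ) hin (by linarith))
  obtain ⟨f, hf, k, hk, hne⟩ := hV _ _ (φ.toEquiv.injective.ne hpq)
  exact hne (by rw [key f hf, key k hk])

end VeryAmple

end WeightedGraph

theorem corollary8 (Γ : WeightedGraph.{u, v}) (hΓ : Γ.Connected) :
    -- divisors of degree at least `2g + 1` are very ample
    (∀ D : Γ.Divisor, 2 * Γ.genus + 1 ≤ D.degree → WeightedGraph.VeryAmple D) ∧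
    -- ample divisors are those of positive degree (on a curve which is not a single point)
    (Nontrivial Γ.Point → ∀ D : Γ.Divisor, WeightedGraph.Ample D ↔ 0 < D.degree) ∧
    -- the coefficient at `P` of a `P`-reduced divisor
    (∀ (D E : Γ.Divisor) (P : Γ.Point), WeightedGraph.LinEquiv E D →
      WeightedGraph.IsReduced P E → D.degree - Γ.genus ≤ E P) ∧
    -- degree `2g` is enough if there are no points of degree one and no banana model of genus `g`
    ((∀ x : Γ.Point, WeightedGraph.deg x ≠ 1) →
      (¬ ∃ (H : WeightedGraph.{0, 0}) (p q : H.V), H.IsBanana Γ.genus p q ∧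
        Nonempty (WeightedGraph.MetricIso H Γ)) →
      ∀ D : Γ.Divisor, 2 * Γ.genus ≤ D.degree → WeightedGraph.VeryAmple D) ∧
    -- degree `2g` is not enough if there is such a model
    (∀ (H : WeightedGraph.{0, 0}) (p q : H.V), H.IsBanana Γ.genus p q →
      ∀ φ : WeightedGraph.MetricIso H Γ,
        ¬ WeightedGraph.VeryAmple
          (Finsupp.single (φ.toEquiv (.vertex p)) Γ.genus +
            Finsupp.single (φ.toEquiv (.vertex q)) Γ.genus : Γ.Divisor)) := by
  refine ⟨fun D hD => WeightedGraph.veryAmple_of_degree hΓ hD,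
    fun _ D => WeightedGraph.ample_iff hΓ D, ?_, ?_,
    fun H p q h φ => WeightedGraph.not_veryAmple_of_isBanana h φ⟩
  · rintro D _ P ⟨f, rfl⟩ hred
    have := hred.isFunRed.degree_sub_genus_le
    rwa [WeightedGraph.degree_add_div] at this
  · intro hdeg hno D hD P Q hPQ
    by_contra! hcon
    have hg := hΓ.genus_nonneg
    obtain ⟨E, hP, hQ, hE⟩ :=
      WeightedGraph.exists_isFunRed_isFunRed hΓ (by linarith) hcon
    have h1 := hP.degree_sub_genus_le
    have h2 := hQ.degree_sub_genus_le
    exact hno (WeightedGraph.exists_banana hΓ hPQ hdeg hP hQ (by linarith) (by linarith))
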